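/- Let $d\ge 1$ be an integer, $s\in\mathbb R$, $\tau,h>0$, and let $C$ be a $d\times d$ real matrix valued function of $(t,\theta)$. Put $X=L^2([-\tau,0],\mathbb R^d)$, $X^+=L^2([0,h],\mathbb R^d)$, $X^\pm=L^2([-\tau,h],\mathbb R^d)$. For $(\phi,w)\in X\times X^+$ let $V(\phi,w)\in X^\pm$ be equal to $w$ on $(0,h]$ and to $\phi$ on $[-\tau,0]$, and let $V^-\phi=V(\phi,0)$, $V^+w=V(0,w)$. Let $\mathcal F\colon X^\pm\to X^+$, $\mathcal F v(t)=\int_{-\tau}^0 C(s+t,\theta)\,v(t+\theta)\,d\theta$. Let $H^{1,+}=H^1([0,h],\mathbb R^d)\subset X^+$, normed by $\|w\|_{H^{1,+}}^2=\|w\|_{X^+}^2+\|w'\|_{X^+}^2$ with $w'$ the weak derivative. Assume (H1) $C\in L^\infty([s,s+h]\times[-\tau,0],\mathbb R^{d\times d})$; (H2) $\mathcal F V^+$ maps $X^+$ into $H^{1,+}$ and is bounded as an operator $X^+\to H^{1,+}$. Let $\widetilde X^+$ be any linear subspace of $X^+$ that contains $H^{1,+}$ and whose elements can be evaluated pointwise: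 to each $w\in\widetilde X^+$ is assigned, linearly in $w$, one of its representatives, which on $[0,h]$ is the continuous one whenever $w$ has a continuous representative (for instance $\widetilde X^+=H^{1,+}$ or $\widetilde X^+=C([0,h],\mathbb R^d)$ with the usual evaluation). Let $\theta_1<\dots<\theta_N$ be the zeros of the Legendre polynomial of degree $N$ on $[0,h]$, with Lagrange polynomials $\ell_1,\dots,\ell_N$, and let $\mathcal L_N^+\colon\widetilde X^+\to X^+$, $\mathcal L_N^+w=\sum_{i=1}^N \ell_i\,w(\theta_i)$. Then $I-\mathcal F V^+\colon X^+\to X^+$ is invertible with bounded inverse, and there is a positive integer $N_0$ such that for every $N\ge N_0$: 1. the operator $I-\mathcal L_N^+\mathcal F V^+\colon X^+\to X^+$ is invertible and $$\|(I-\mathcal L_N^+\mathcal F V^+)^{-1}\|_{X^+\leftarrow X^+}\le 2\,\|(I-\mathcal F V^+)^{-1}\|_{X^+\leftarrow X^+};$$ 2. for each $\phi\in X$ the equation $w=\mathcal F V(\phi,w)$ has a unique solution $w^*\in X^+$, and if $\mathcal F V^-\phi\in\widetilde X^+$ (so that the next equation is meaningful), then the equation $w=\mathcal L_N^+\mathcal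 F V(\phi,w)$ has a unique solution $w_N^*\in X^+$, moreover $w^*\in\widetilde X^+$, and $$\|w_N^*-w^*\|_{X^+}\le 2\,\|(I-\mathcal F V^+)^{-1}\|_{X^+\leftarrow X^+}\,\|\mathcal L_N^+w^*-w^*\|_{X^+}.$$ -/

import Mathlib

noncomputable section

namespace RenewalCollocation

open MeasureTheory Set
open scoped ENNReal

/-- `ℝ^d` with the Euclidean norm. -/
abbrev Vec (d : ℕ) : Type := EuclideanSpace ℝ (Fin d)

/-- Lebesgue measure on the interval `[a, b]`. -/
abbrev leb (a b : ℝ) : Measure ℝ := volume.restrict (Icc a b)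

/-- The space `L²([a, b], ℝ^d)`. With `[a, b] = [-τ, 0]`, `[0, h]`, `[-τ, h]` this gives the
state space `X`, the space `X⁺` and the space `X^±`. -/
abbrev L2 (d : ℕ) (a b : ℝ) : Type := Lp (Vec d) 2 (leb a b)

/-! ### The operators `V`, `V⁻`, `V⁺` -/

section V

variable {d : ℕ} {τ h : ℝ}

/-- Pointwise formula of `V`: the value is `w t` on `(0, h]` and `φ t` on `[-τ, 0]`. -/
def glueFun (h : ℝ) (φ w : ℝ → Vec d) : ℝ → Vec d :=
  open Classical in fun t => if t ∈ Ioc 0 h then w t else φ t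

theorem glueFun_eq_piecewise (h : ℝ) (φ w : ℝ → Vec d) :
    glueFun h φ w = open Classical in (Ioc 0 h).piecewise w φ := by
  rfl

theorem restrict_Ioc_le (τ h : ℝ) :
    (leb (-τ) h).restrict (Ioc 0 h) ≤ leb 0 h := by
  rw [leb, Measure.restrict_restrict measurableSet_Ioc]
  exact Measure.restrict_mono (fun x hx => Ioc_subset_Icc_self hx.1) le_rfl

theorem restrict_compl_le (τ h : ℝ) :
    (leb (-τ) h).restrict (Ioc 0 h)ᶜ ≤ leb (-τ) 0 := by
  rw [leb, Measure.restrict_restrict measurableSet_Ioc.compl]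
  have hsub : (Ioc 0 h)ᶜ ∩ Icc (-τ) h ⊆ Icc (-τ) 0 := by
    intro x hx
    refine ⟨hx.2.1, ?_⟩
    by_contra hlt
    exact hx.1 ⟨not_le.mp hlt, hx.2.2⟩
  exact Measure.restrict_mono hsub le_rfl

theorem memLp_glueFun (φ : L2 d (-τ) 0) (w : L2 d 0 h) :
    MemLp (glueFun h φ w) 2 (leb (-τ) h) := by
  classical
  rw [glueFun_eq_piecewise]
  exact MemLp.piecewise measurableSet_Ioc
    ((Lp.memLp w).mono_measure (restrict_Ioc_le τ h))
    ((Lp.memLp φ).mono_measure (restrict_compl_le τ h))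

theorem glueFun_congr_ae {φ φ' w w' : ℝ → Vec d} (hφ : φ =ᵐ[leb (-τ) 0] φ')
    (hw : w =ᵐ[leb 0 h] w') : glueFun h φ w =ᵐ[leb (-τ) h] glueFun h φ' w' := by
  have h1 := ae_mono (restrict_Ioc_le τ h) hw
  have h2 := ae_mono (restrict_compl_le τ h) hφ
  have h1' := (ae_restrict_iff' measurableSet_Ioc).1 h1
  have h2' := (ae_restrict_iff' measurableSet_Ioc.compl).1 h2
  filter_upwards [h1', h2'] with t ht1 ht2
  unfold glueFun
  split_ifs with ht
  · exact ht1 ht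
  · exact ht2 ht

/-- The operator `V : X × X⁺ → X^±`. -/
def V (d : ℕ) (τ h : ℝ) : (L2 d (-τ) 0 × L2 d 0 h) →ₗ[ℝ] L2 d (-τ) h where
  toFun p := (memLp_glueFun p.1 p.2).toLp (glueFun h p.1 p.2)
  map_add' p q := by
    rw [← MemLp.toLp_add, MemLp.toLp_eq_toLp_iff]
    refine (glueFun_congr_ae (Lp.coeFn_add p.1 q.1) (Lp.coeFn_add p.2 q.2)).trans ?_
    refine Filter.Eventually.of_forall fun t => ?_
    simp only [glueFun, Pi.add_apply]
    split_ifs <;> rfl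
  map_smul' c p := by
    rw [RingHom.id_apply, ← MemLp.toLp_const_smul, MemLp.toLp_eq_toLp_iff]
    refine (glueFun_congr_ae (Lp.coeFn_smul c p.1) (Lp.coeFn_smul c p.2)).trans ?_
    refine Filter.Eventually.of_forall fun t => ?_
    simp only [glueFun, Pi.smul_apply]
    split_ifs <;> rfl

/-- `V⁻ φ = V(φ, 0)`. -/
def Vminus (d : ℕ) (τ h : ℝ) : L2 d (-τ) 0 →ₗ[ℝ] L2 d (-τ) h :=
  V d τ h ∘ₗ LinearMap.inl ℝ _ _

/-- `V⁺ w = V(0, w)`. -/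
def Vplus (d : ℕ) (τ h : ℝ) : L2 d 0 h →ₗ[ℝ] L2 d (-τ) h :=
  V d τ h ∘ₗ LinearMap.inr ℝ _ _

end V

/-! ### The operator `𝓕` -/

section F

variable {d : ℕ} {s τ h : ℝ} {C : ℝ → ℝ → Matrix (Fin d) (Fin d) ℝ}

/-- Hypothesis (H1): `C ∈ L^∞([s, s+h] × [-τ, 0], ℝ^{d×d})`. -/
def HypH1 (s τ h : ℝ) (C : ℝ → ℝ → Matrix (Fin d) (Fin d) ℝ) : Prop :=
  ∀ i j, MemLp (fun p : ℝ × ℝ => C p.1 p.2 i j) ∞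
    (volume.restrict (Icc s (s + h) ×ˢ Icc (-τ) 0))

/-- Pointwise formula of `𝓕`: the function `t ↦ ∫_{-τ}^0 C(s+t, θ) v(t+θ) dθ`. -/
def delayIntegral (s τ : ℝ) (C : ℝ → ℝ → Matrix (Fin d) (Fin d) ℝ) (v : ℝ → Vec d) (t : ℝ) :
    Vec d :=
  ∫ θ in Icc (-τ) 0, (C (s + t) θ).toEuclideanLin (v (t + θ))

theorem leb_prod (τ h : ℝ) :
    (leb 0 h).prod (leb (-τ) 0) = volume.restrict (Icc 0 h ×ˢ Icc (-τ) 0) := by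
  rw [leb, leb, Measure.prod_restrict]; rfl

theorem shift_measurePreserving (s τ h : ℝ) :
    MeasurePreserving (fun p : ℝ × ℝ => (s + p.1, p.2)) ((leb 0 h).prod (leb (-τ) 0))
      (volume.restrict (Icc s (s + h) ×ˢ Icc (-τ) 0)) := by
  have h1 : MeasurePreserving (fun p : ℝ × ℝ => (s + p.1, p.2)) volume volume :=
    (measurePreserving_add_left volume s).prod (MeasurePreserving.id volume)
  have h2 := h1.restrict_preimage (s := Icc s (s + h) ×ˢ Icc (-τ) 0)
    (measurableSet_Icc.prod measurableSet_Icc)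
  have hpre : (fun p : ℝ × ℝ => (s + p.1, p.2)) ⁻¹' (Icc s (s + h) ×ˢ Icc (-τ) 0) =
      Icc 0 h ×ˢ Icc (-τ) 0 := by
    ext ⟨a, b⟩
    simp
  rw [hpre] at h2
  rw [leb_prod]
  exact h2

theorem HypH1.memLp_shift (hC : HypH1 s τ h C) (i j : Fin d) :
    MemLp (fun p : ℝ × ℝ => C (s + p.1) p.2 i j) ∞ ((leb 0 h).prod (leb (-τ) 0)) :=
  (hC i j).comp_measurePreserving (shift_measurePreserving s τ h)

theorem HypH1.exists_bound (hC : HypH1 s τ h C) :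
    ∃ K : ℝ, 0 ≤ K ∧ ∀ᵐ t ∂(leb 0 h), ∀ᵐ θ ∂(leb (-τ) 0), ∀ i j, |C (s + t) θ i j| ≤ K := by
  have hb : ∀ i j, ∃ K : ℝ, ∀ᵐ p ∂((leb 0 h).prod (leb (-τ) 0)), |C (s + p.1) p.2 i j| ≤ K := by
    intro i j
    refine ⟨(eLpNormEssSup (fun p : ℝ × ℝ => C (s + p.1) p.2 i j)
      ((leb 0 h).prod (leb (-τ) 0))).toReal, ?_⟩
    have hfin : eLpNormEssSup (fun p : ℝ × ℝ => C (s + p.1) p.2 i j)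
      ((leb 0 h).prod (leb (-τ) 0)) ≠ ∞ := by
      have := (hC.memLp_shift i j).2
      rw [eLpNorm_exponent_top] at this
      exact this.ne
    filter_upwards [enorm_ae_le_eLpNormEssSup (fun p : ℝ × ℝ => C (s + p.1) p.2 i j)
      ((leb 0 h).prod (leb (-τ) 0))] with p hp
    rw [← Real.norm_eq_abs, ← toReal_enorm]
    exact ENNReal.toReal_mono hfin hp
  choose K hK using hb
  refine ⟨∑ i, ∑ j, |K i j|, by positivity, ?_⟩
  have hall : ∀ᵐ p ∂((leb 0 h).prod (leb (-τ) 0)), ∀ i j, |C (s + p.1) p.2 i j| ≤ K i j := by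
    simp only [ae_all_iff]; exact hK
  filter_upwards [Measure.ae_ae_of_ae_prod hall] with t ht
  filter_upwards [ht] with θ hθ i j
  calc |C (s + t) θ i j| ≤ K i j := hθ i j
    _ ≤ |K i j| := le_abs_self _
    _ ≤ ∑ j, |K i j| :=
      Finset.single_le_sum (f := fun j => |K i j|) (fun _ _ => abs_nonneg _) (Finset.mem_univ j)
    _ ≤ ∑ i, ∑ j, |K i j| :=
      Finset.single_le_sum (f := fun i => ∑ j, |K i j|)
        (fun _ _ => Finset.sum_nonneg fun _ _ => abs_nonneg _) (Finset.mem_univ i)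

theorem toEuclideanLin_eq_sum (A : Matrix (Fin d) (Fin d) ℝ) (x : Vec d) :
    A.toEuclideanLin x = ∑ i, ∑ j, (A i j * x j) • EuclideanSpace.single i (1 : ℝ) := by
  ext k
  simp [Matrix.mulVec, dotProduct, Finset.sum_apply, Pi.single_apply]

theorem norm_toEuclideanLin_le (A : Matrix (Fin d) (Fin d) ℝ) (x : Vec d) {K : ℝ}
    (hA : ∀ i j, |A i j| ≤ K) : ‖A.toEuclideanLin x‖ ≤ (d * (d * K)) * ‖x‖ := by
  rw [toEuclideanLin_eq_sum]
  have hterm : ∀ i j, ‖(A i j * x j) • EuclideanSpace.single i (1 : ℝ)‖ ≤ K * ‖x‖ := by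
    intro i j
    rw [norm_smul, PiLp.norm_single, norm_one, mul_one, norm_mul]
    exact mul_le_mul (hA i j) (PiLp.norm_apply_le x j) (norm_nonneg _)
      ((abs_nonneg _).trans (hA i j))
  calc _ ≤ ∑ i : Fin d, ∑ j : Fin d, K * ‖x‖ :=
        (norm_sum_le _ _).trans (Finset.sum_le_sum fun i _ =>
          (norm_sum_le _ _).trans (Finset.sum_le_sum fun j _ => hterm i j))
    _ = _ := by simp; ring

theorem HypH1.aestronglyMeasurable (hC : HypH1 s τ h C) (v : L2 d (-τ) h) :
    AEStronglyMeasurable (fun p : ℝ × ℝ => (C (s + p.1) p.2).toEuclideanLin (v (p.1 + p.2)))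
      ((leb 0 h).prod (leb (-τ) 0)) := by
  simp only [toEuclideanLin_eq_sum]
  refine Finset.aestronglyMeasurable_fun_sum _ fun i _ =>
    Finset.aestronglyMeasurable_fun_sum _ fun j _ => ?_
  refine AEStronglyMeasurable.smul_const (AEStronglyMeasurable.mul (hC.memLp_shift i j).1 ?_) _
  have h1 : StronglyMeasurable fun p : ℝ × ℝ => v (p.1 + p.2) :=
    (Lp.stronglyMeasurable v).comp_measurable (measurable_fst.add measurable_snd)
  exact ((EuclideanSpace.proj (𝕜 := ℝ) j).continuous.comp_stronglyMeasurable h1).aestronglyMeasurable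

theorem translate_measurePreserving (τ t : ℝ) :
    MeasurePreserving (fun θ : ℝ => t + θ) (leb (-τ) 0) (leb (t - τ) t) := by
  have h2 := (measurePreserving_add_left volume t).restrict_preimage (s := Icc (t - τ) t)
    measurableSet_Icc
  have hpre : (fun θ : ℝ => t + θ) ⁻¹' Icc (t - τ) t = Icc (-τ) 0 := by
    ext x
    simp [sub_eq_add_neg]
  rw [hpre] at h2
  exact h2

theorem leb_translate_le {t : ℝ} (ht : t ∈ Icc 0 h) : leb (t - τ) t ≤ leb (-τ) h :=
  Measure.restrict_mono (Icc_subset_Icc (by linarith [ht.1]) ht.2) le_rfl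

theorem integrable_L2 (v : L2 d (-τ) h) : Integrable v (leb (-τ) h) :=
  (Lp.memLp v).integrable (by norm_num)

theorem integrable_translate (v : L2 d (-τ) h) {t : ℝ} (ht : t ∈ Icc 0 h) :
    Integrable (fun θ => v (t + θ)) (leb (-τ) 0) :=
  (translate_measurePreserving τ t).integrable_comp_of_integrable
    ((integrable_L2 v).mono_measure (leb_translate_le ht))

theorem integral_translate_le (v : L2 d (-τ) h) {t : ℝ} (ht : t ∈ Icc 0 h) :
    ∫ θ, ‖v (t + θ)‖ ∂(leb (-τ) 0) ≤ ∫ u, ‖v u‖ ∂(leb (-τ) h) := by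
  have h1 := (translate_measurePreserving τ t).integral_comp
    (measurableEmbedding_addLeft t) (fun u => ‖v u‖)
  rw [h1]
  exact integral_mono_measure (leb_translate_le ht)
    (Filter.Eventually.of_forall fun _ => norm_nonneg _) (integrable_L2 v).norm

theorem HypH1.ae_integrable (hC : HypH1 s τ h C) (v : L2 d (-τ) h) :
    ∀ᵐ t ∂(leb 0 h), Integrable (fun θ => (C (s + t) θ).toEuclideanLin (v (t + θ)))
      (leb (-τ) 0) := by
  obtain ⟨K, -, hK⟩ := hC.exists_bound
  filter_upwards [hK, (hC.aestronglyMeasurable v).prodMk_left,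
    ae_restrict_mem measurableSet_Icc] with t hKt hmt ht
  refine ((integrable_translate v ht).norm.const_mul (d * (d * K))).mono' hmt ?_
  filter_upwards [hKt] with θ hθ
  exact norm_toEuclideanLin_le _ _ hθ

theorem HypH1.memLp_delayIntegral (hC : HypH1 s τ h C) (v : L2 d (-τ) h) :
    MemLp (delayIntegral s τ C v) 2 (leb 0 h) := by
  obtain ⟨K, hK0, hK⟩ := hC.exists_bound
  refine MemLp.of_bound (hC.aestronglyMeasurable v).integral_prod_right'
    ((d * (d * K)) * ∫ u, ‖v u‖ ∂(leb (-τ) h)) ?_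
  filter_upwards [hK, ae_restrict_mem measurableSet_Icc] with t hKt ht
  calc ‖delayIntegral s τ C v t‖
      ≤ ∫ θ, (d * (d * K)) * ‖v (t + θ)‖ ∂(leb (-τ) 0) := by
        refine norm_integral_le_of_norm_le ((integrable_translate v ht).norm.const_mul _) ?_
        filter_upwards [hKt] with θ hθ
        exact norm_toEuclideanLin_le _ _ hθ
    _ = (d * (d * K)) * ∫ θ, ‖v (t + θ)‖ ∂(leb (-τ) 0) := integral_const_mul _ _
    _ ≤ _ := mul_le_mul_of_nonneg_left (integral_translate_le v ht) (by positivity)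

theorem delayIntegral_congr {v v' : ℝ → Vec d} (hv : v =ᵐ[leb (-τ) h] v') {t : ℝ}
    (ht : t ∈ Icc 0 h) : delayIntegral s τ C v t = delayIntegral s τ C v' t := by
  refine integral_congr_ae ?_
  have := (translate_measurePreserving τ t).quasiMeasurePreserving.ae
    (ae_mono (leb_translate_le ht) hv)
  filter_upwards [this] with θ hθ
  simp only [hθ]

/-- The operator `𝓕 : X^± → X⁺`, `𝓕 v (t) = ∫_{-τ}^0 C(s+t, θ) v(t+θ) dθ`, well defined
under (H1). -/
def F (hC : HypH1 s τ h C) : L2 d (-τ) h →ₗ[ℝ] L2 d 0 h where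
  toFun v := (hC.memLp_delayIntegral v).toLp (delayIntegral s τ C v)
  map_add' v w := by
    rw [← MemLp.toLp_add, MemLp.toLp_eq_toLp_iff]
    filter_upwards [hC.ae_integrable v, hC.ae_integrable w,
      ae_restrict_mem measurableSet_Icc] with t hv hw ht
    rw [delayIntegral_congr (Lp.coeFn_add v w) ht]
    simp only [delayIntegral, Pi.add_apply, map_add]
    exact integral_add hv hw
  map_smul' c v := by
    rw [RingHom.id_apply, ← MemLp.toLp_const_smul, MemLp.toLp_eq_toLp_iff]
    filter_upwards [ae_restrict_mem measurableSet_Icc] with t ht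
    rw [delayIntegral_congr (Lp.coeFn_smul c v) ht]
    simp only [delayIntegral, Pi.smul_apply, map_smul]
    exact integral_smul c _

/-- The operator `𝓕 V⁺ : X⁺ → X⁺`. -/
def FVplus (hC : HypH1 s τ h C) : L2 d 0 h →ₗ[ℝ] L2 d 0 h := F hC ∘ₗ Vplus d τ h

/-- The operator `𝓕 V⁻ : X → X⁺`. -/
def FVminus (hC : HypH1 s τ h C) : L2 d (-τ) 0 →ₗ[ℝ] L2 d 0 h := F hC ∘ₗ Vminus d τ h

end F

/-! ### The Sobolev space `H¹([0, h], ℝ^d)` -/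

section Sobolev

variable {d : ℕ} {h : ℝ}

/-- `g` is a weak derivative of `w` on `(0, h)`. -/
def HasWeakDeriv (w g : L2 d 0 h) : Prop :=
  ∀ ψ : ℝ → ℝ, ContDiff ℝ (⊤ : ℕ∞) ψ → HasCompactSupport ψ → tsupport ψ ⊆ Ioo 0 h →
    ∫ t in Icc 0 h, deriv ψ t • w t = - ∫ t in Icc 0 h, ψ t • g t

theorem integrable_test {ψ : ℝ → ℝ} (hψ : Continuous ψ) (hc : HasCompactSupport ψ)
    (w : L2 d 0 h) : Integrable (fun t => ψ t • w t) (leb 0 h) := by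
  obtain ⟨K, hK⟩ := hψ.bounded_above_of_compact_support hc
  exact ((Lp.memLp w).integrable (by norm_num)).bdd_smul K hψ.aestronglyMeasurable
    (Filter.Eventually.of_forall hK)

theorem integral_test_add (ψ : ℝ → ℝ) (hψ : Continuous ψ) (hc : HasCompactSupport ψ)
    (w w' : L2 d 0 h) : ∫ t in Icc 0 h, ψ t • (w + w' : L2 d 0 h) t =
      (∫ t in Icc 0 h, ψ t • w t) + ∫ t in Icc 0 h, ψ t • w' t := by
  rw [← integral_add (integrable_test hψ hc w) (integrable_test hψ hc w')]
  refine integral_congr_ae ?_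
  filter_upwards [Lp.coeFn_add w w'] with t ht
  rw [ht, Pi.add_apply, smul_add]

theorem integral_test_smul (ψ : ℝ → ℝ) (c : ℝ) (w : L2 d 0 h) :
    ∫ t in Icc 0 h, ψ t • (c • w : L2 d 0 h) t = c • ∫ t in Icc 0 h, ψ t • w t := by
  rw [← integral_smul]
  refine integral_congr_ae ?_
  filter_upwards [Lp.coeFn_smul c w] with t ht
  rw [ht, Pi.smul_apply, smul_comm]

/-- The Sobolev space `H¹([0, h], ℝ^d)` as a linear subspace of `X⁺ = L²([0, h], ℝ^d)`. -/
def sobolev (d : ℕ) (h : ℝ) : Submodule ℝ (L2 d 0 h) where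
  carrier := {w | ∃ g, HasWeakDeriv w g}
  zero_mem' := by
    refine ⟨0, fun ψ _ _ _ => ?_⟩
    have h0 := integral_test_smul (d := d) (h := h) (deriv ψ) 0 0
    have h1 := integral_test_smul (d := d) (h := h) ψ 0 0
    simp only [zero_smul] at h0 h1
    rw [h0, h1, neg_zero]
  add_mem' := by
    rintro w w' ⟨g, hg⟩ ⟨g', hg'⟩
    refine ⟨g + g', fun ψ h1 h2 h3 => ?_⟩
    rw [integral_test_add _ (h1.continuous_deriv (by simp)) h2.deriv,
      integral_test_add _ h1.continuous h2, hg ψ h1 h2 h3, hg' ψ h1 h2 h3, neg_add]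
  smul_mem' := by
    rintro c w ⟨g, hg⟩
    refine ⟨c • g, fun ψ h1 h2 h3 => ?_⟩
    rw [integral_test_smul, integral_test_smul, hg ψ h1 h2 h3, smul_neg]

/-- Hypothesis (H2): `𝓕 V⁺` has range contained in `H¹` and is bounded from `X⁺` to `H¹`,
the norm of `H¹` being given by `‖w‖² + ‖w'‖²` with `w'` the weak derivative. -/
def HypH2 {s τ : ℝ} {C : ℝ → ℝ → Matrix (Fin d) (Fin d) ℝ} (hC : HypH1 s τ h C) : Prop :=
  (∀ w, FVplus hC w ∈ sobolev d h) ∧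
    ∃ K : ℝ, ∀ w g, HasWeakDeriv (FVplus hC w) g →
      Real.sqrt (‖FVplus hC w‖ ^ 2 + ‖g‖ ^ 2) ≤ K * ‖w‖

end Sobolev

/-! ### Lagrange interpolation at the Legendre zeros -/

section Interpolation

variable {d : ℕ} {h : ℝ}

/-- A linear subspace `X̃⁺` of `X⁺` which contains `H¹` and whose elements can be evaluated
pointwise: to each class in `X̃⁺` is assigned, linearly, one of its representatives, which on
`[0, h]` is the continuous one whenever the class has a continuous representative. -/
structure EvaluationSpace (d : ℕ) (h : ℝ) where
  carrier : Submodule ℝ (L2 d 0 h)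
  eval : carrier →ₗ[ℝ] (ℝ → Vec d)
  eval_ae : ∀ w : carrier, eval w =ᵐ[leb 0 h] (w : L2 d 0 h)
  sobolev_le : sobolev d h ≤ carrier
  eval_of_continuousOn : ∀ (w : carrier) (g : ℝ → Vec d), ContinuousOn g (Icc 0 h) →
    (w : L2 d 0 h) =ᵐ[leb 0 h] g → EqOn (eval w) g (Icc 0 h)

/-- The Legendre polynomial of degree `N` on `[0, h]` (up to a nonzero factor): the shifted
Legendre polynomial on `[0, 1]` composed with `t ↦ t / h`. -/
def legendre (h : ℝ) (N : ℕ) : Polynomial ℝ :=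
  ((Polynomial.shiftedLegendre N).map (Int.castRingHom ℝ)).comp
    (Polynomial.C h⁻¹ * Polynomial.X)

/-- The collocation nodes `θ₁ < ⋯ < θ_N`: the zeros of the Legendre polynomial of degree `N`
on `[0, h]`. -/
def nodes (h : ℝ) (N : ℕ) : Finset ℝ := (legendre h N).roots.toFinset

/-- The Lagrange polynomial of the node `θ`. -/
def lagrangePoly (h : ℝ) (N : ℕ) (θ : ℝ) : Polynomial ℝ := Lagrange.basis (nodes h N) id θ

/-- The function `t ↦ ∑_θ ℓ_θ(t) f(θ)` interpolating `f` at the nodes. -/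
def interpFun (h : ℝ) (N : ℕ) (f : ℝ → Vec d) (t : ℝ) : Vec d :=
  ∑ θ ∈ nodes h N, (lagrangePoly h N θ).eval t • f θ

theorem memLp_interpFun (N : ℕ) (f : ℝ → Vec d) : MemLp (interpFun h N f) 2 (leb 0 h) := by
  have hc : Continuous (interpFun h N f) := by
    unfold interpFun
    exact continuous_finsetSum _ fun θ _ => (Polynomial.continuous _).smul continuous_const
  obtain ⟨K, hK⟩ := (isCompact_Icc (a := (0 : ℝ)) (b := h)).exists_bound_of_continuousOn
    hc.continuousOn
  refine MemLp.of_bound hc.aestronglyMeasurable K ?_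
  filter_upwards [ae_restrict_mem measurableSet_Icc] with t ht using hK t ht

/-- The Lagrange interpolation operator `𝓛_N⁺ : X̃⁺ → X⁺`. -/
def interp (Y : EvaluationSpace d h) (N : ℕ) : Y.carrier →ₗ[ℝ] L2 d 0 h where
  toFun w := (memLp_interpFun N (Y.eval w)).toLp (interpFun h N (Y.eval w))
  map_add' v w := by
    rw [← MemLp.toLp_add, MemLp.toLp_eq_toLp_iff]
    refine Filter.Eventually.of_forall fun t => ?_
    simp [interpFun, Finset.sum_add_distrib]
  map_smul' c w := by
    rw [RingHom.id_apply, ← MemLp.toLp_const_smul, MemLp.toLp_eq_toLp_iff]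
    refine Filter.Eventually.of_forall fun t => ?_
    simp [interpFun, Finset.smul_sum, smul_comm c]

end Interpolation

/-! ### The equations -/

section Equations

variable {d : ℕ} {s τ h : ℝ} {C : ℝ → ℝ → Matrix (Fin d) (Fin d) ℝ}

/-- The operator `I - 𝓕 V⁺ : X⁺ → X⁺`. -/
def exactOp (hC : HypH1 s τ h C) : L2 d 0 h →ₗ[ℝ] L2 d 0 h :=
  LinearMap.id - FVplus hC

/-- The operator `I - 𝓛_N⁺ 𝓕 V⁺ : X⁺ → X⁺`, defined since the range of `𝓕 V⁺` lies
in `H¹ ⊆ X̃⁺`. -/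
def collocationOp {hC : HypH1 s τ h C} (hF : HypH2 hC) (Y : EvaluationSpace d h) (N : ℕ) :
    L2 d 0 h →ₗ[ℝ] L2 d 0 h :=
  LinearMap.id - interp Y N ∘ₗ
    (FVplus hC).codRestrict Y.carrier fun w => Y.sobolev_le (hF.1 w)

/-- The bounded operator `S` is the two-sided inverse of the linear operator `A`. -/
def IsBoundedInverse (A : L2 d 0 h →ₗ[ℝ] L2 d 0 h) (S : L2 d 0 h →L[ℝ] L2 d 0 h) : Prop :=
  (∀ w, S (A w) = w) ∧ ∀ w, A (S w) = w

/-- The fixed point equation `w = 𝓕 V(φ, w)`. -/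
def IsFixedPoint (hC : HypH1 s τ h C) (φ : L2 d (-τ) 0) (w : L2 d 0 h) : Prop :=
  w = F hC (V d τ h (φ, w))

/-- The collocation equation `w = 𝓛_N⁺ 𝓕 V(φ, w)`, including that the right-hand side is
meaningful. -/
def IsCollocationSolution (hC : HypH1 s τ h C) (Y : EvaluationSpace d h) (N : ℕ)
    (φ : L2 d (-τ) 0) (w : L2 d 0 h) : Prop :=
  ∃ hm : F hC (V d τ h (φ, w)) ∈ Y.carrier, w = interp Y N ⟨F hC (V d τ h (φ, w)), hm⟩

end Equations

end RenewalCollocation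

end

open RenewalCollocation

/-!
On `L²([0, h])` the operator `𝓕 V⁺` is dominated by a Volterra operator with constant kernel, so a
power of it is a contraction and `I - 𝓕 V⁺` has a bounded inverse. By (H2) and the representation
of `H¹` functions as primitives, the image of the unit ball under `𝓕 V⁺` consists of
`1/2`-Hölder functions with a common constant.

Gauss quadrature at the Legendre zeros makes the Lagrange polynomials `L²`-orthogonal, with
`∫ ℓ_i² = ∫ ℓ_i` and `∑ ∫ ℓ_i = h`, so interpolation is bounded by `√h` from the sup norm to `L²`
uniformly in `N`. As it reproduces polynomials of degree less than `N`, the interpolation error is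
controlled by the error of best uniform approximation, which Bernstein polynomials bound uniformly
over a Hölder ball. Hence `𝓛_N⁺ 𝓕 V⁺ → 𝓕 V⁺` in operator norm, a Neumann series inverts
`I - 𝓛_N⁺ 𝓕 V⁺`, and applying it to `w_N* - w*` gives `𝓛_N⁺ w* - w*`.
-/

namespace RenewalCollocation

open MeasureTheory Set
open scoped ENNReal NNReal

section Orthogonality

open Polynomial

theorem splits_derivative {p : ℝ[X]} (hp : p.Splits) : (derivative p).Splits := by
  have hcard : p.roots.card = p.natDegree := splits_iff_card_roots.1 hp
  have hrolle : p.roots.card ≤ (derivative p).roots.card + 1 := card_roots_le_derivative p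
  have hdeg : (derivative p).natDegree ≤ p.natDegree - 1 := natDegree_derivative_le p
  have hroots : (derivative p).roots.card ≤ (derivative p).natDegree := card_roots' _
  exact splits_iff_card_roots.2 (by omega)

theorem splits_iterate_derivative {p : ℝ[X]} (hp : p.Splits) (n : ℕ) :
    (derivative^[n] p).Splits := by
  induction n with
  | zero => exact hp
  | succ n ih => simpa only [Function.iterate_succ_apply'] using splits_derivative ih

theorem eval_iterate_derivative_eq_zero_of_pow_dvd {R : Type*} [CommRing R] {p : R[X]} {a : R}
    {n k : ℕ} (hk : k < n) (hp : (X - C a) ^ n ∣ p) : (derivative^[k] p).eval a = 0 :=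
  dvd_iff_isRoot.1 ((dvd_pow_self _ (Nat.sub_ne_zero_of_lt hk)).trans
    (pow_sub_dvd_iterate_derivative_of_pow_dvd k hp))

theorem integral_iterate_derivative_mul_eq_zero {p q : ℝ[X]} {a b : ℝ} {n : ℕ}
    (ha : (X - C a) ^ n ∣ p) (hb : (X - C b) ^ n ∣ p) (hq : q.degree < n) :
    ∫ t in a..b, (derivative^[n] p).eval t * q.eval t = 0 := by
  induction n generalizing q with
  | zero => simp [degree_eq_bot.1 (Nat.WithBot.lt_zero_iff.1 hq)]
  | succ n ih =>
    have hq' : (derivative q).degree < n := by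
      rcases eq_or_ne q 0 with rfl | h0
      · simp
      · exact (degree_derivative_lt h0).trans_le (degree_le_of_natDegree_le
          (Nat.lt_succ_iff.1 ((natDegree_lt_iff_degree_lt h0).2 hq)))
    have hparts := intervalIntegral.integral_mul_deriv_eq_deriv_mul (a := a) (b := b)
      (fun t _ => q.hasDerivAt t) (fun t _ => (derivative^[n] p).hasDerivAt t)
      ((derivative q).continuous.intervalIntegrable a b)
      ((derivative (derivative^[n] p)).continuous.intervalIntegrable a b)
    have hlower := ih ((pow_dvd_pow _ n.le_succ).trans ha) ((pow_dvd_pow _ n.le_succ).trans hb) hq'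
    simp only [mul_comm (eval _ (derivative^[n] p))] at hlower
    simpa only [Function.iterate_succ_apply', mul_comm, hlower,
      eval_iterate_derivative_eq_zero_of_pow_dvd n.lt_succ_self ha,
      eval_iterate_derivative_eq_zero_of_pow_dvd n.lt_succ_self hb, zero_mul, sub_zero] using hparts

/-- `p` is orthogonal in `L²(a, b)` to all polynomials of lower degree. -/
def IsOrthogonalToLowerDegree (a b : ℝ) (p : ℝ[X]) : Prop :=
  ∀ q : ℝ[X], q.degree < p.degree → ∫ t in a..b, p.eval t * q.eval t = 0

theorem integral_eval_pos {a b : ℝ} (hab : a < b) {q : ℝ[X]} (hq : q ≠ 0)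
    (hnonneg : ∀ t ∈ Ioc a b, 0 ≤ q.eval t) : 0 < ∫ t in a..b, q.eval t := by
  obtain ⟨t, ht, hroot⟩ : ∃ t ∈ Ioc a b, t ∉ q.roots.toFinset :=
    (Ioc_infinite hab).exists_notMem_finset _
  refine intervalIntegral.integral_pos hab q.continuous.continuousOn hnonneg
    ⟨t, Ioc_subset_Icc_self ht, (hnonneg t ht).lt_of_ne' fun h0 => hroot ?_⟩
  exact Multiset.mem_toFinset.2 ((mem_roots hq).2 h0)

namespace IsOrthogonalToLowerDegree

variable {a b : ℝ} {p : ℝ[X]}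

theorem not_sq_dvd (horth : IsOrthogonalToLowerDegree a b p) (hab : a < b) (hp : p ≠ 0) (θ : ℝ) :
    ¬(X - C θ) ^ 2 ∣ p := by
  rintro ⟨q, rfl⟩
  have hq : q ≠ 0 := right_ne_zero_of_mul hp
  have hpos : 0 < ∫ t in a..b, (((X - C θ) * q) ^ 2).eval t :=
    integral_eval_pos hab (pow_ne_zero 2 (mul_ne_zero (X_sub_C_ne_zero θ) hq))
      fun t _ => by rw [eval_pow]; positivity
  refine hpos.ne' (Eq.trans ?_ (horth q ?_))
  · congr 1 with t
    simp only [eval_mul, eval_pow]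
    ring
  · refine degree_lt_degree ?_
    rw [natDegree_mul (pow_ne_zero 2 (X_sub_C_ne_zero θ)) hq, natDegree_pow, natDegree_X_sub_C]
    omega

theorem nodup_roots (horth : IsOrthogonalToLowerDegree a b p) (hab : a < b) : p.roots.Nodup := by
  rcases eq_or_ne p 0 with rfl | hp
  · simp
  refine Multiset.nodup_iff_count_le_one.2 fun θ => ?_
  rw [count_roots, ← not_lt]
  exact fun hmult => horth.not_sq_dvd hab hp θ ((le_rootMultiplicity_iff hp).1 hmult)

theorem mem_Ioo_of_isRoot (horth : IsOrthogonalToLowerDegree a b p) (hab : a < b) (hp : p ≠ 0)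
    {θ : ℝ} (hθ : p.IsRoot θ) : θ ∈ Ioo a b := by
  obtain ⟨q, rfl⟩ := dvd_iff_isRoot.2 hθ
  have hq : q ≠ 0 := right_ne_zero_of_mul hp
  have hprod : (X - C θ) * q ^ 2 ≠ 0 := mul_ne_zero (X_sub_C_ne_zero θ) (pow_ne_zero 2 hq)
  have hint : ∫ t in a..b, ((X - C θ) * q ^ 2).eval t = 0 := by
    refine Eq.trans ?_ (horth q ?_)
    · congr 1 with t
      simp only [eval_mul, eval_pow]
      ring
    · refine degree_lt_degree ?_
      rw [natDegree_mul (X_sub_C_ne_zero θ) hq, natDegree_X_sub_C]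
      omega
  by_contra hθI
  rcases le_or_gt θ a with hle | hlt
  · refine (integral_eval_pos hab hprod fun t ht => ?_).ne' hint
    simp only [eval_mul, eval_sub, eval_X, eval_C, eval_pow]
    exact mul_nonneg (by linarith [ht.1]) (sq_nonneg _)
  · have hge : b ≤ θ := not_lt.1 fun h => hθI ⟨hlt, h⟩
    have hneg : ∫ t in a..b, (-((X - C θ) * q ^ 2)).eval t = 0 := by
      simp only [eval_neg, intervalIntegral.integral_neg, hint, neg_zero]
    refine (integral_eval_pos hab (neg_ne_zero.2 hprod) fun t ht => ?_).ne' hneg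
    simp only [eval_neg, eval_mul, eval_sub, eval_X, eval_C, eval_pow, ← neg_mul]
    exact mul_nonneg (by linarith [ht.2]) (sq_nonneg _)

theorem integral_eq_zero_of_dvd (horth : IsOrthogonalToLowerDegree a b p) {q : ℝ[X]} (hdvd : p ∣ q)
    (hq : q.natDegree < 2 * p.natDegree) : ∫ t in a..b, q.eval t = 0 := by
  obtain ⟨r, rfl⟩ := hdvd
  simp only [eval_mul]
  rcases eq_or_ne r 0 with rfl | hr
  · simp
  have hp : p ≠ 0 := by rintro rfl; simp at hq
  refine horth r (degree_lt_degree ?_)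
  rw [natDegree_mul hp hr] at hq
  omega

end IsOrthogonalToLowerDegree

end Orthogonality

section Legendre

open Polynomial

theorem iterate_derivative_comp_C_mul_X {R : Type*} [CommRing R] (p : R[X]) (a : R) (n : ℕ) :
    derivative^[n] (p.comp (C a * X)) = C (a ^ n) * (derivative^[n] p).comp (C a * X) := by
  induction n with
  | zero => simp
  | succ n ih =>
    rw [Function.iterate_succ_apply', ih, Function.iterate_succ_apply', derivative_C_mul,
      derivative_comp]
    simp only [derivative_C_mul, derivative_X, mul_one, pow_succ, C_mul]
    ring

variable {h : ℝ}

theorem legendre_eq_iterate_derivative (hh : h ≠ 0) (N : ℕ) :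
    legendre h N =
      C ((-h)⁻¹ ^ N * (N.factorial : ℝ)⁻¹) * derivative^[N] (X ^ N * (X - C h) ^ N) := by
  have hrodrigues : (N.factorial : ℝ[X]) * (shiftedLegendre N).map (Int.castRingHom ℝ) =
      derivative^[N] (X ^ N * (1 - X) ^ N) := by
    simpa [← iterate_derivative_map] using
      congrArg (Polynomial.map (Int.castRingHom ℝ)) (factorial_mul_shiftedLegendre_eq N)
  have hcancel : (C h * C h⁻¹ : ℝ[X]) = 1 := by rw [← C_mul, mul_inv_cancel₀ hh, C_1]
  have hscale : (X ^ N * (X - C h) ^ N : ℝ[X]) =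
      C (h ^ N * (-h) ^ N) * (X ^ N * (1 - X) ^ N : ℝ[X]).comp (C h⁻¹ * X) := by
    have hX : (X : ℝ[X]) = C h * (C h⁻¹ * X) := by rw [← mul_assoc, hcancel, one_mul]
    have hXh : (X - C h : ℝ[X]) = C (-h) * (1 - C h⁻¹ * X) := by
      rw [C_neg]; linear_combination -X * hcancel
    simp only [mul_comp, pow_comp, X_comp, sub_comp, one_comp, C_mul, C_pow]
    rw [hXh, ← mul_pow, ← mul_pow, ← mul_pow, ← mul_pow]
    congr 1
    linear_combination (C (-h) * (1 - C h⁻¹ * X)) * hX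
  have hfactor : (-h)⁻¹ ^ N * (N.factorial : ℝ)⁻¹ * h ^ N * (-h) ^ N * h⁻¹ ^ N * N.factorial
      = 1 := by
    have hfact : (N.factorial : ℝ) ≠ 0 := mod_cast N.factorial_ne_zero
    rw [inv_pow, inv_pow]
    field_simp [pow_ne_zero N (neg_ne_zero.2 hh)]
  rw [hscale, iterate_derivative_C_mul, iterate_derivative_comp_C_mul_X, ← hrodrigues, mul_comp,
    natCast_comp, ← C_eq_natCast]
  simp only [← mul_assoc, ← C_mul, hfactor, C_1, one_mul, legendre]

theorem natDegree_legendre (hh : h ≠ 0) (N : ℕ) : (legendre h N).natDegree = N := by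
  rw [legendre, natDegree_comp, natDegree_C_mul_X _ (inv_ne_zero hh), mul_one,
    natDegree_map_eq_of_injective (Int.cast_injective : Function.Injective (Int.castRingHom ℝ)),
    natDegree_shiftedLegendre]

theorem isOrthogonalToLowerDegree_legendre (hh : h ≠ 0) (N : ℕ) :
    IsOrthogonalToLowerDegree 0 h (legendre h N) := by
  intro q hq
  have hN : q.degree < N := hq.trans_le (degree_le_of_natDegree_le (natDegree_legendre hh N).le)
  have horth := integral_iterate_derivative_mul_eq_zero (a := 0) (b := h)
    (p := X ^ N * (X - C h) ^ N) (by simp) (dvd_mul_left _ _) hN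
  simp only [legendre_eq_iterate_derivative hh, eval_mul (p := C _), eval_C, mul_assoc,
    intervalIntegral.integral_const_mul, horth, mul_zero]

theorem splits_legendre (hh : h ≠ 0) (N : ℕ) : (legendre h N).Splits := by
  rw [legendre_eq_iterate_derivative hh]
  exact (Splits.C _).mul (splits_iterate_derivative
    ((Splits.X.pow N).mul ((Splits.X_sub_C h).pow N)) N)

theorem card_nodes (hh : 0 < h) (N : ℕ) : (nodes h N).card = N := by
  rw [nodes, Multiset.toFinset_card_of_nodup
    ((isOrthogonalToLowerDegree_legendre hh.ne' N).nodup_roots hh),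
    ← (splits_legendre hh.ne' N).natDegree_eq_card_roots, natDegree_legendre hh.ne']

theorem nodes_subset_Ioo (hh : 0 < h) (N : ℕ) : (nodes h N : Set ℝ) ⊆ Ioo 0 h := by
  intro θ hθ
  have hroot := mem_roots'.1 (Multiset.mem_toFinset.1 hθ)
  exact (isOrthogonalToLowerDegree_legendre hh.ne' N).mem_Ioo_of_isRoot hh hroot.1 hroot.2

end Legendre

section Quadrature

open Polynomial Finset

/-- `s` is the node set of a Gauss quadrature rule on `[a, b]`: the interpolatory rule with nodes
`s` is exact in degree less than `2 * #s`. Equivalently, and this is the form taken as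
definition, polynomials of such a degree vanishing on `s` have zero integral. -/
def IsGaussNodes (a b : ℝ) (s : Finset ℝ) : Prop :=
  ∀ q : ℝ[X], q.natDegree < 2 * #s → (∀ θ ∈ s, q.eval θ = 0) → ∫ t in a..b, q.eval t = 0

theorem IsOrthogonalToLowerDegree.isGaussNodes {a b : ℝ} {p : ℝ[X]}
    (horth : IsOrthogonalToLowerDegree a b p) (hab : a < b) (hp : p.Splits) :
    IsGaussNodes a b p.roots.toFinset := by
  have hnodup : p.roots.Nodup := horth.nodup_roots hab
  intro q hq hvanish
  rcases eq_or_ne q 0 with rfl | hq0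
  · simp
  rw [Multiset.toFinset_card_of_nodup hnodup, ← hp.natDegree_eq_card_roots] at hq
  have hp0 : p ≠ 0 := by rintro rfl; simp at hq
  have hroots : p.roots ≤ q.roots := (Multiset.le_iff_subset hnodup).2 fun θ hθ =>
    (mem_roots hq0).2 (hvanish θ (Multiset.mem_toFinset.2 hθ))
  exact horth.integral_eq_zero_of_dvd (hp.dvd_of_roots_le_roots hp0 hroots) hq

theorem isGaussNodes_nodes {h : ℝ} (hh : 0 < h) (N : ℕ) : IsGaussNodes 0 h (nodes h N) :=
  (isOrthogonalToLowerDegree_legendre hh.ne' N).isGaussNodes hh (splits_legendre hh.ne' N)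

variable {E : Type*}

/-- Lagrange interpolation of vector valued functions at the nodes `s`. -/
noncomputable def lagrangeInterp [AddCommGroup E] [Module ℝ E] (s : Finset ℝ) :
    (ℝ → E) →ₗ[ℝ] (ℝ → E) where
  toFun f t := ∑ θ ∈ s, (Lagrange.basis s id θ).eval t • f θ
  map_add' f g := by ext t; simp [Finset.sum_add_distrib]
  map_smul' c f := by ext t; simp [Finset.smul_sum, smul_comm c]

theorem lagrangeInterp_apply [AddCommGroup E] [Module ℝ E] (s : Finset ℝ) (f : ℝ → E) (t : ℝ) :
    lagrangeInterp s f t = ∑ θ ∈ s, (Lagrange.basis s id θ).eval t • f θ := rfl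

theorem continuous_lagrangeInterp [NormedAddCommGroup E] [NormedSpace ℝ E] (s : Finset ℝ)
    (f : ℝ → E) :
    Continuous (lagrangeInterp s f) :=
  continuous_finsetSum s fun θ _ => (Lagrange.basis s id θ).continuous.smul continuous_const

/-- The `E`-valued polynomial functions of degree less than `n`. -/
def polynomialFunctions (E : Type*) [AddCommGroup E] [Module ℝ E] (n : ℕ) :
    Submodule ℝ (ℝ → E) :=
  Submodule.span ℝ {f | ∃ p : ℝ[X], p.degree < n ∧ ∃ v : E, f = fun t => p.eval t • v}

theorem lagrangeInterp_eq_self [AddCommGroup E] [Module ℝ E] {s : Finset ℝ} {f : ℝ → E}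
    (hf : f ∈ polynomialFunctions E #s) : lagrangeInterp s f = f := by
  induction hf using Submodule.span_induction with
  | zero => exact map_zero _
  | add f g _ _ hf hg => rw [map_add, hf, hg]
  | smul c f _ hf => rw [map_smul, hf]
  | mem f hf =>
    obtain ⟨p, hp, v, rfl⟩ := hf
    ext t
    have hinterp : p.eval t = ∑ θ ∈ s, p.eval θ * (Lagrange.basis s id θ).eval t := by
      conv_lhs => rw [Lagrange.eq_interpolate (Set.injOn_id _) hp]
      simp [Lagrange.interpolate_apply, eval_finsetSum]
    simp only [lagrangeInterp_apply, hinterp, Finset.sum_smul, smul_smul, mul_comm]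

theorem continuous_of_mem_polynomialFunctions [NormedAddCommGroup E] [NormedSpace ℝ E] {n : ℕ}
    {f : ℝ → E} (hf : f ∈ polynomialFunctions E n) : Continuous f := by
  induction hf using Submodule.span_induction with
  | zero => exact continuous_const
  | add f g _ _ hf hg => exact hf.add hg
  | smul c f _ hf => exact hf.const_smul c
  | mem f hf =>
    obtain ⟨p, -, v, rfl⟩ := hf
    exact p.continuous.smul continuous_const

theorem eval_basis_eq_ite {s : Finset ℝ} {θ ξ : ℝ} (hθ : θ ∈ s) (hξ : ξ ∈ s) :
    (Lagrange.basis s id θ).eval ξ = if θ = ξ then 1 else 0 := by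
  split_ifs with heq
  · exact heq ▸ Lagrange.eval_basis_self (Set.injOn_id _) hθ
  · exact Lagrange.eval_basis_of_ne (v := id) heq hξ

theorem natDegree_basis_lt_card {s : Finset ℝ} {θ : ℝ} (hθ : θ ∈ s) :
    (Lagrange.basis s id θ).natDegree < #s := by
  rw [Lagrange.natDegree_basis (Set.injOn_id _) hθ]
  exact Nat.sub_lt (card_pos.2 ⟨θ, hθ⟩) one_pos

namespace IsGaussNodes

variable [NormedAddCommGroup E] {a b : ℝ} {s : Finset ℝ}

theorem integral_basis_mul_basis (hs : IsGaussNodes a b s) {θ η : ℝ} (hθ : θ ∈ s) (hη : η ∈ s)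
    (hne : θ ≠ η) :
    ∫ t in a..b, (Lagrange.basis s id θ).eval t * (Lagrange.basis s id η).eval t = 0 := by
  simp only [← eval_mul]
  refine hs _ (natDegree_mul_le.trans_lt ?_) fun ξ hξ => ?_
  · linarith [natDegree_basis_lt_card hθ, natDegree_basis_lt_card hη]
  · rw [eval_mul, eval_basis_eq_ite hθ hξ, eval_basis_eq_ite hη hξ]
    split_ifs with h₁ h₂ <;> simp_all

theorem integral_basis_mul_self (hs : IsGaussNodes a b s) {θ : ℝ} (hθ : θ ∈ s) :
    ∫ t in a..b, (Lagrange.basis s id θ).eval t * (Lagrange.basis s id θ).eval t =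
      ∫ t in a..b, (Lagrange.basis s id θ).eval t := by
  rw [← sub_eq_zero, ← intervalIntegral.integral_sub
    (Continuous.intervalIntegrable (by fun_prop) _ _)
    (Continuous.intervalIntegrable (by fun_prop) _ _)]
  simp only [← eval_mul, ← eval_sub]
  refine hs _ ((natDegree_sub_le _ _).trans_lt (max_lt (natDegree_mul_le.trans_lt ?_) ?_))
    fun ξ hξ => ?_
  · linarith [natDegree_basis_lt_card hθ]
  · linarith [natDegree_basis_lt_card hθ]
  · rw [eval_sub, eval_mul, eval_basis_eq_ite hθ hξ]
    split_ifs <;> simp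

theorem integral_basis_nonneg (hs : IsGaussNodes a b s) (hab : a ≤ b) {θ : ℝ} (hθ : θ ∈ s) :
    0 ≤ ∫ t in a..b, (Lagrange.basis s id θ).eval t := by
  rw [← hs.integral_basis_mul_self hθ]
  exact intervalIntegral.integral_nonneg hab fun t _ => mul_self_nonneg _

theorem integral_norm_lagrangeInterp_sq [InnerProductSpace ℝ E] (hs : IsGaussNodes a b s)
    (f : ℝ → E) :
    ∫ t in a..b, ‖lagrangeInterp s f t‖ ^ 2 =
      ∑ θ ∈ s, (∫ t in a..b, (Lagrange.basis s id θ).eval t) * ‖f θ‖ ^ 2 := by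
  have hexpand (t : ℝ) : ‖lagrangeInterp s f t‖ ^ 2 = ∑ θ ∈ s, ∑ η ∈ s,
      (Lagrange.basis s id θ).eval t * (Lagrange.basis s id η).eval t * inner ℝ (f η) (f θ) := by
    simp only [← real_inner_self_eq_norm_sq, lagrangeInterp_apply, sum_inner, inner_sum,
      real_inner_smul_left, real_inner_smul_right, mul_assoc]
  simp only [hexpand]
  rw [intervalIntegral.integral_finsetSum
    fun θ _ => Continuous.intervalIntegrable (by fun_prop) _ _]
  refine Finset.sum_congr rfl fun θ hθ => ?_
  rw [intervalIntegral.integral_finsetSum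
    fun η _ => Continuous.intervalIntegrable (by fun_prop) _ _]
  simp only [intervalIntegral.integral_mul_const]
  rw [Finset.sum_eq_single_of_mem θ hθ, hs.integral_basis_mul_self hθ,
    real_inner_self_eq_norm_sq]
  intro η hη hne
  rw [hs.integral_basis_mul_basis hθ hη hne.symm, zero_mul]

theorem integral_norm_lagrangeInterp_sq_le [InnerProductSpace ℝ E] (hs : IsGaussNodes a b s)
    (hab : a ≤ b) {f : ℝ → E} {B : ℝ} (hf : ∀ θ ∈ s, ‖f θ‖ ≤ B) :
    ∫ t in a..b, ‖lagrangeInterp s f t‖ ^ 2 ≤ (b - a) * B ^ 2 := by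
  rcases s.eq_empty_or_nonempty with rfl | hne
  · simpa [lagrangeInterp_apply] using mul_nonneg (sub_nonneg.2 hab) (sq_nonneg B)
  have hweights : ∑ θ ∈ s, ∫ t in a..b, (Lagrange.basis s id θ).eval t = b - a := by
    rw [← intervalIntegral.integral_finsetSum
      fun θ _ => (Polynomial.continuous _).intervalIntegrable _ _]
    simp [← eval_finsetSum, Lagrange.sum_basis (Set.injOn_id _) hne]
  rw [hs.integral_norm_lagrangeInterp_sq, ← hweights, Finset.sum_mul]
  gcongr with θ hθ
  · exact hs.integral_basis_nonneg hab hθ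
  · exact hf θ hθ

theorem integral_norm_lagrangeInterp_sub_sq_le [InnerProductSpace ℝ E] (hs : IsGaussNodes a b s)
    (hsub : (s : Set ℝ) ⊆ Icc a b) (hab : a ≤ b) {f p : ℝ → E} (hf : ContinuousOn f (Icc a b))
    (hp : p ∈ polynomialFunctions E #s) {B : ℝ} (hB : ∀ t ∈ Icc a b, ‖f t - p t‖ ≤ B) :
    ∫ t in a..b, ‖lagrangeInterp s f t - f t‖ ^ 2 ≤ 4 * ((b - a) * B ^ 2) := by
  have herr : ContinuousOn (fun t => f t - p t) (Icc a b) :=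
    hf.sub (continuous_of_mem_polynomialFunctions hp).continuousOn
  have hsplit (t : ℝ) : lagrangeInterp s f t - f t = lagrangeInterp s (f - p) t - (f t - p t) := by
    rw [map_sub, lagrangeInterp_eq_self hp, Pi.sub_apply]
    abel
  have hstable : ∫ t in a..b, ‖lagrangeInterp s (f - p) t‖ ^ 2 ≤ (b - a) * B ^ 2 :=
    hs.integral_norm_lagrangeInterp_sq_le hab fun θ hθ => hB θ (hsub hθ)
  have hintI : IntervalIntegrable (fun t => ‖lagrangeInterp s (f - p) t‖ ^ 2) volume a b :=
    ((continuous_lagrangeInterp s _).norm.pow 2).intervalIntegrable a b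
  have hintE : IntervalIntegrable (fun t => ‖f t - p t‖ ^ 2) volume a b :=
    (herr.norm.pow 2).intervalIntegrable_of_Icc hab
  have hbest : ∫ t in a..b, ‖f t - p t‖ ^ 2 ≤ (b - a) * B ^ 2 := by
    rw [← smul_eq_mul, ← intervalIntegral.integral_const]
    refine intervalIntegral.integral_mono_on hab hintE intervalIntegrable_const fun t ht => ?_
    gcongr
    exact hB t ht
  calc ∫ t in a..b, ‖lagrangeInterp s f t - f t‖ ^ 2
      ≤ ∫ t in a..b, 2 * (‖lagrangeInterp s (f - p) t‖ ^ 2 + ‖f t - p t‖ ^ 2) := by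
        refine intervalIntegral.integral_mono_on hab
          ((((continuous_lagrangeInterp s f).continuousOn.sub hf).norm.pow 2
            ).intervalIntegrable_of_Icc hab) ((hintI.add hintE).const_mul 2) fun t _ => ?_
        rw [hsplit]
        exact (pow_le_pow_left₀ (norm_nonneg _) (norm_sub_le _ _) 2).trans add_sq_le
    _ = 2 * ((∫ t in a..b, ‖lagrangeInterp s (f - p) t‖ ^ 2) + ∫ t in a..b, ‖f t - p t‖ ^ 2) := by
        rw [intervalIntegral.integral_const_mul, intervalIntegral.integral_add hintI hintE]
    _ ≤ 4 * ((b - a) * B ^ 2) := by linarith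

end IsGaussNodes

end Quadrature

section Bernstein

open Polynomial
open scoped unitInterval

theorem sum_bernstein_mul_abs_sub_rpow_le {n : ℕ} (hn : n ≠ 0) {r : ℝ} (hr₀ : 0 ≤ r) (hr₂ : r ≤ 2)
    (x : I) :
    ∑ k : Fin (n + 1), bernstein n k x * |(x : ℝ) - bernstein.z k| ^ r ≤ (1 / n : ℝ) ^ (r / 2) := by
  have hconcave := Real.concaveOn_rpow (p := r / 2) (by linarith) (by linarith)
  calc ∑ k : Fin (n + 1), bernstein n k x * |(x : ℝ) - bernstein.z k| ^ r
      = ∑ k : Fin (n + 1), bernstein n k x • (((x : ℝ) - bernstein.z k) ^ 2) ^ (r / 2) := by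
        refine Finset.sum_congr rfl fun k _ => ?_
        rw [smul_eq_mul, ← sq_abs, ← Real.rpow_natCast_mul (abs_nonneg _), Nat.cast_ofNat,
          mul_div_cancel₀ r two_ne_zero]
    _ ≤ (∑ k : Fin (n + 1), bernstein n k x • ((x : ℝ) - bernstein.z k) ^ 2) ^ (r / 2) :=
        hconcave.le_map_sum (fun _ _ => bernstein_nonneg) (bernstein.probability n x)
          fun _ _ => Set.mem_Ici.2 (sq_nonneg _)
    _ = ((x : ℝ) * (1 - x) / n) ^ (r / 2) := by
        simp only [smul_eq_mul, mul_comm (bernstein _ _ _), bernstein.variance hn]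
    _ ≤ (1 / n : ℝ) ^ (r / 2) := by
        have hx₀ : 0 ≤ (x : ℝ) := x.2.1
        have hx₁ : 0 ≤ 1 - (x : ℝ) := sub_nonneg.2 x.2.2
        gcongr
        nlinarith

theorem degree_bernsteinPolynomial_comp_lt {n : ℕ} (k : Fin (n + 1)) (c a : ℝ) :
    ((bernsteinPolynomial ℝ n k).comp (C c * (X - C a))).degree < (n + 1 : ℕ) := by
  have hlin : (C c * (X - C a)).natDegree ≤ 1 := by compute_degree
  have hbern : (bernsteinPolynomial ℝ n k).natDegree ≤ n :=
    calc ((n.choose k : ℝ[X]) * X ^ (k : ℕ) * (1 - X) ^ (n - k)).natDegree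
        ≤ k + (n - k) := by compute_degree
      _ ≤ n := by lia
  refine degree_le_natDegree.trans_lt (Nat.cast_lt.2 (Nat.lt_succ_of_le ?_))
  calc ((bernsteinPolynomial ℝ n k).comp (C c * (X - C a))).natDegree
      ≤ n * 1 := natDegree_comp_le.trans (Nat.mul_le_mul hbern hlin)
    _ = n := mul_one n

variable {E : Type*} [NormedAddCommGroup E] [NormedSpace ℝ E]

theorem exists_polynomialFunction_norm_sub_le_of_holderOnWith {a b : ℝ} (hab : a < b) {f : ℝ → E}
    {K r : ℝ≥0} (hf : HolderOnWith K r f (Icc a b)) (hr : r ≤ 2) {n : ℕ} (hn : n ≠ 0) :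
    ∃ p ∈ polynomialFunctions E (n + 1), ∀ t ∈ Icc a b,
      ‖f t - p t‖ ≤ K * (b - a) ^ (r : ℝ) * (1 / n : ℝ) ^ (r / 2 : ℝ) := by
  have hba : 0 < b - a := sub_pos.2 hab
  have hnode (x : I) : a + (b - a) * x ∈ Icc a b :=
    ⟨by nlinarith [x.2.1], by nlinarith [x.2.2]⟩
  let p (k : Fin (n + 1)) : ℝ[X] := (bernsteinPolynomial ℝ n k).comp (C (b - a)⁻¹ * (X - C a))
  refine ⟨fun t => ∑ k, (p k).eval t • f (a + (b - a) * bernstein.z k), ?_, fun t ht => ?_⟩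
  · simp only [← Finset.sum_fn]
    exact Submodule.sum_mem _ fun k _ => Submodule.subset_span
      ⟨p k, degree_bernsteinPolynomial_comp_lt k _ _, _, rfl⟩
  obtain ⟨x, rfl⟩ : ∃ x : I, a + (b - a) * x = t :=
    ⟨⟨(t - a) / (b - a), div_nonneg (by linarith [ht.1]) hba.le,
      (div_le_one hba).2 (by linarith [ht.2])⟩, by field_simp; ring⟩
  have heval (k : Fin (n + 1)) : (p k).eval (a + (b - a) * x) = bernstein n k x := by
    simp [p, bernstein, inv_mul_cancel_left₀ hba.ne']
  calc ‖f (a + (b - a) * x) -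
        ∑ k, (p k).eval (a + (b - a) * x) • f (a + (b - a) * bernstein.z k)‖
      = ‖∑ k : Fin (n + 1), bernstein n k x •
          (f (a + (b - a) * x) - f (a + (b - a) * bernstein.z k))‖ := by
        simp only [heval, smul_sub, Finset.sum_sub_distrib, ← Finset.sum_smul,
          bernstein.probability, one_smul]
    _ ≤ ∑ k : Fin (n + 1), bernstein n k x *
          (K * (b - a) ^ (r : ℝ) * |(x : ℝ) - bernstein.z k| ^ (r : ℝ)) := by
        refine (norm_sum_le _ _).trans (Finset.sum_le_sum fun k _ => ?_)
        rw [norm_smul, Real.norm_of_nonneg bernstein_nonneg, ← dist_eq_norm]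
        gcongr
        refine (hf.dist_le (hnode x) (hnode (bernstein.z k))).trans_eq ?_
        rw [mul_assoc, ← Real.mul_rpow hba.le (abs_nonneg _), Real.dist_eq, add_sub_add_left_eq_sub,
          ← mul_sub, abs_mul, abs_of_pos hba]
    _ = K * (b - a) ^ (r : ℝ) * ∑ k : Fin (n + 1),
          bernstein n k x * |(x : ℝ) - bernstein.z k| ^ (r : ℝ) := by
        simp only [Finset.mul_sum, mul_left_comm]
    _ ≤ K * (b - a) ^ (r : ℝ) * (1 / n : ℝ) ^ (r / 2 : ℝ) := by
        gcongr
        exact sum_bernstein_mul_abs_sub_rpow_le hn r.2 (mod_cast hr) x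

end Bernstein

section Primitive

theorem one_sub_inv_toReal_nonneg {p : ℝ≥0∞} (hp : 1 ≤ p) : 0 ≤ 1 - p.toReal⁻¹ := by
  rcases eq_or_ne p ∞ with rfl | hp'
  · simp
  · exact sub_nonneg.2 (inv_le_one_of_one_le₀ (by simpa using ENNReal.toReal_mono hp' hp))

variable {E : Type*} [NormedAddCommGroup E] [NormedSpace ℝ E] {a b : ℝ} {g : ℝ → E}

theorem holderOnWith_intervalIntegral {p : ℝ≥0∞} (hp : 1 ≤ p) (hg : MemLp g p (leb a b)) :
    HolderOnWith (eLpNorm g p (leb a b)).toNNReal (1 - p.toReal⁻¹).toNNReal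
      (fun t => ∫ r in a..t, g r) (Icc a b) := by
  intro t ht u hu
  have hint (x : ℝ) (hx : x ∈ Icc a b) : IntervalIntegrable g volume a x :=
    (intervalIntegrable_iff_integrableOn_Icc_of_le hx.1).2
      ((hg.integrable hp).mono_measure (Measure.restrict_mono (Icc_subset_Icc_right hx.2) le_rfl))
  have hsub : uIoc u t ⊆ Icc a b := uIoc_subset_uIcc.trans (uIcc_subset_Icc hu ht)
  have hle : volume.restrict (uIoc u t) ≤ leb a b := Measure.restrict_mono hsub le_rfl
  calc edist (∫ r in a..t, g r) (∫ r in a..u, g r)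
      = ‖∫ r in uIoc u t, g r‖ₑ := by
        rw [edist_eq_enorm_sub, intervalIntegral.integral_interval_sub_left (hint t ht) (hint u hu),
          ← ofReal_norm, intervalIntegral.norm_intervalIntegral_eq, ofReal_norm]
    _ ≤ eLpNorm g 1 (volume.restrict (uIoc u t)) := by
        rw [eLpNorm_one_eq_lintegral_enorm]
        exact enorm_integral_le_lintegral_enorm g
    _ ≤ eLpNorm g p (volume.restrict (uIoc u t)) *
          volume.restrict (uIoc u t) univ ^ (1 / (1 : ℝ≥0∞).toReal - 1 / p.toReal) :=
        eLpNorm_le_eLpNorm_mul_rpow_measure_univ hp (hg.1.mono_measure hle)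
    _ ≤ eLpNorm g p (leb a b) * edist t u ^ (1 - p.toReal⁻¹) := by
        gcongr
        simp [Real.volume_uIoc, edist_dist, Real.dist_eq]
    _ = _ := by
        rw [ENNReal.coe_toNNReal hg.2.ne, Real.coe_toNNReal _ (one_sub_inv_toReal_nonneg hp)]

theorem integral_smul_intervalIntegral_eq [CompleteSpace E] {φ : ℝ → ℝ}
    (hφ : Integrable φ (leb a b)) (hg : Integrable g (leb a b)) :
    ∫ t in Icc a b, φ t • ∫ r in a..t, g r = ∫ r in Icc a b, (∫ t in r..b, φ t) • g r := by
  let T : Set (ℝ × ℝ) := {q | q.2 ≤ q.1}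
  have hT : MeasurableSet T := measurableSet_le measurable_snd measurable_fst
  have hinner (t) (ht : t ∈ Icc a b) : φ t • ∫ r in a..t, g r =
      ∫ r in Icc a b, T.indicator (fun q => φ q.1 • g q.2) (t, r) := by
    rw [intervalIntegral.integral_of_le ht.1, ← integral_Icc_eq_integral_Ioc, ← integral_smul,
      ← inter_eq_right.2 (Icc_subset_Icc_right ht.2 : Icc a t ⊆ Icc a b),
      ← setIntegral_indicator measurableSet_Icc]
    refine setIntegral_congr_fun measurableSet_Icc fun r hr => ?_
    simp [T, indicator_apply, hr.1]
  have houter (r) (hr : r ∈ Icc a b) : (∫ t in r..b, φ t) • g r =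
      ∫ t in Icc a b, T.indicator (fun q => φ q.1 • g q.2) (t, r) := by
    rw [intervalIntegral.integral_of_le hr.2, ← integral_Icc_eq_integral_Ioc,
      ← integral_smul_const, ← inter_eq_right.2 (Icc_subset_Icc_left hr.1 : Icc r b ⊆ Icc a b),
      ← setIntegral_indicator measurableSet_Icc]
    refine setIntegral_congr_fun measurableSet_Icc fun t ht => ?_
    simp [T, indicator_apply, ht.2]
  rw [setIntegral_congr_fun measurableSet_Icc hinner,
    setIntegral_congr_fun measurableSet_Icc houter]
  exact integral_integral_swap ((hφ.smul_prod hg).indicator hT)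

end Primitive

section Sobolev

/-- The test functions of the open interval `(a, b)`, as functions on the whole line. -/
structure IsTestFunction (a b : ℝ) (ψ : ℝ → ℝ) : Prop where
  contDiff : ContDiff ℝ (⊤ : ℕ∞) ψ
  hasCompactSupport : HasCompactSupport ψ
  tsupport_subset : tsupport ψ ⊆ Ioo a b

namespace IsTestFunction

variable {E : Type*} [NormedAddCommGroup E] [NormedSpace ℝ E] {a b : ℝ} {ψ χ : ℝ → ℝ}

theorem eq_zero (hψ : IsTestFunction a b ψ) {t : ℝ} (ht : t ∉ Ioo a b) : ψ t = 0 :=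
  image_eq_zero_of_notMem_tsupport fun hm => ht (hψ.tsupport_subset hm)

theorem const_mul (hψ : IsTestFunction a b ψ) (c : ℝ) : IsTestFunction a b fun t => c * ψ t where
  contDiff := contDiff_const.mul hψ.contDiff
  hasCompactSupport := hψ.hasCompactSupport.mul_left
  tsupport_subset :=
    (closure_mono (Function.support_const_smul_subset c ψ)).trans hψ.tsupport_subset

theorem sub (hψ : IsTestFunction a b ψ) (hχ : IsTestFunction a b χ) :
    IsTestFunction a b fun t => ψ t - χ t where
  contDiff := hψ.contDiff.sub hχ.contDiff
  hasCompactSupport := hψ.hasCompactSupport.sub hχ.hasCompactSupport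
  tsupport_subset := (tsupport_sub ψ χ).trans (union_subset hψ.tsupport_subset hχ.tsupport_subset)

theorem deriv (hψ : IsTestFunction a b ψ) : IsTestFunction a b (deriv ψ) where
  contDiff := (contDiff_infty_iff_deriv.1 hψ.contDiff).2
  hasCompactSupport := hψ.hasCompactSupport.deriv
  tsupport_subset := (tsupport_deriv_subset (𝕜 := ℝ)).trans hψ.tsupport_subset

theorem integrable_smul {μ : Measure ℝ} (hψ : IsTestFunction a b ψ) {u : ℝ → E}
    (hu : Integrable u μ) : Integrable (fun t => ψ t • u t) μ := by
  have hcont := hψ.contDiff.continuous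
  obtain ⟨K, hK⟩ := hcont.bounded_above_of_compact_support hψ.hasCompactSupport
  exact hu.bdd_smul K hcont.aestronglyMeasurable (Filter.Eventually.of_forall hK)

theorem integrable (hψ : IsTestFunction a b ψ) : Integrable ψ :=
  hψ.contDiff.continuous.integrable_of_hasCompactSupport hψ.hasCompactSupport

theorem setIntegral_Icc_eq (hψ : IsTestFunction a b ψ) : ∫ t in Icc a b, ψ t = ∫ t, ψ t :=
  setIntegral_eq_integral_of_forall_compl_eq_zero fun _ ht =>
    hψ.eq_zero fun hm => ht (Ioo_subset_Icc_self hm)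

theorem exists_integral_eq_one (hab : a < b) : ∃ ρ, IsTestFunction a b ρ ∧ ∫ t, ρ t = 1 := by
  let B : ContDiffBump ((a + b) / 2) := ⟨(b - a) / 8, (b - a) / 4, by linarith, by linarith⟩
  refine ⟨B.normed volume, ⟨B.contDiff_normed, B.hasCompactSupport_normed, ?_⟩, B.integral_normed⟩
  rw [B.tsupport_normed_eq, Real.closedBall_eq_Icc]
  change Icc ((a + b) / 2 - (b - a) / 4) ((a + b) / 2 + (b - a) / 4) ⊆ Ioo a b
  exact Icc_subset_Ioo (by linarith) (by linarith)

theorem exists_deriv_eq (hψ : IsTestFunction a b ψ) (h₀ : ∫ t, ψ t = 0) :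
    ∃ χ, IsTestFunction a b χ ∧ _root_.deriv χ = ψ := by
  have hcont := hψ.contDiff.continuous
  obtain ⟨c, hac, d, hdb, hcd⟩ : ∃ c > a, ∃ d < b, tsupport ψ ⊆ Icc c d := by
    rcases (tsupport ψ).eq_empty_or_nonempty with hempty | hne
    · exact ⟨a + 1, by simp, b - 1, by simp, by simp [hempty]⟩
    · have hK : IsCompact (tsupport ψ) := hψ.hasCompactSupport
      exact ⟨_, (hψ.tsupport_subset (hK.sInf_mem hne)).1, _,
        (hψ.tsupport_subset (hK.sSup_mem hne)).2, hK.isBounded.subset_Icc_sInf_sSup⟩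
  have hzero (r : ℝ) (hr : r ∉ Icc c d) : ψ r = 0 :=
    image_eq_zero_of_notMem_tsupport fun hm => hr (hcd hm)
  let χ (t : ℝ) : ℝ := ∫ r in Iic t, ψ r
  have hχ (t : ℝ) : HasDerivAt χ (ψ t) t := by
    have hprim : χ = fun t => χ 0 + ∫ r in 0..t, ψ r := by
      funext t
      rw [← intervalIntegral.integral_Iic_sub_Iic hψ.integrable.integrableOn
        hψ.integrable.integrableOn, add_sub_cancel]
    rw [hprim]
    exact (hcont.integral_hasStrictDerivAt 0 t).hasDerivAt.const_add _
  have hderiv : _root_.deriv χ = ψ := funext fun t => (hχ t).deriv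
  have hsupp : Function.support χ ⊆ Icc c d := by
    refine fun t ht => ⟨not_lt.1 fun htc => ht ?_, not_lt.1 fun hdt => ht ?_⟩
    · exact setIntegral_eq_zero_of_forall_eq_zero fun r hr =>
        hzero r fun hm => (hm.1.trans hr).not_gt htc
    · rw [← h₀]
      exact setIntegral_eq_integral_of_forall_compl_eq_zero fun r hr =>
        hzero r fun hm => hr (hm.2.trans hdt.le)
  refine ⟨χ, ⟨contDiff_infty_iff_deriv.2 ⟨fun t => (hχ t).differentiableAt, ?_⟩,
    .of_support_subset_isCompact isCompact_Icc hsupp,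
    (closure_minimal hsupp isClosed_Icc).trans (Icc_subset_Ioo hac hdb)⟩, hderiv⟩
  rw [hderiv]
  exact hψ.contDiff

theorem integral_deriv_smul_intervalIntegral [CompleteSpace E] (hψ : IsTestFunction a b ψ)
    {g : ℝ → E} (hg : Integrable g (leb a b)) :
    ∫ t in Icc a b, _root_.deriv ψ t • ∫ r in a..t, g r = -∫ t in Icc a b, ψ t • g t := by
  have hint (r : ℝ) : ∫ t in r..b, _root_.deriv ψ t = -ψ r := by
    rw [intervalIntegral.integral_deriv_eq_sub
      (fun t _ => (hψ.contDiff.differentiable (by simp)).differentiableAt)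
      (hψ.deriv.contDiff.continuous.intervalIntegrable _ _), hψ.eq_zero (t := b) (by simp),
      zero_sub]
  rw [integral_smul_intervalIntegral_eq hψ.deriv.integrable.restrict hg]
  simp only [hint, neg_smul, integral_neg]

end IsTestFunction

variable {E : Type*} [NormedAddCommGroup E] [NormedSpace ℝ E] [CompleteSpace E] {a b : ℝ}

theorem ae_eq_const_of_integral_deriv_smul_eq_zero (hab : a < b) {u : ℝ → E}
    (hu : Integrable u (leb a b))
    (h₀ : ∀ ψ, IsTestFunction a b ψ → ∫ t in Icc a b, deriv ψ t • u t = 0) :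
    ∃ c, u =ᵐ[leb a b] fun _ => c := by
  obtain ⟨ρ, hρ, hρ₁⟩ := IsTestFunction.exists_integral_eq_one hab
  set c := ∫ t in Icc a b, ρ t • u t
  have horth (χ : ℝ → ℝ) (hχ : IsTestFunction a b χ) :
      ∫ t in Icc a b, χ t • (u t - c) = 0 := by
    set m := ∫ t, χ t
    have hmean : ∫ t, (χ t - m * ρ t) = 0 := by
      rw [integral_sub hχ.integrable (hρ.const_mul m).integrable, integral_const_mul, hρ₁, mul_one,
        sub_self]
    obtain ⟨ψ, hψ, hderiv⟩ := (hχ.sub (hρ.const_mul m)).exists_deriv_eq hmean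
    calc ∫ t in Icc a b, χ t • (u t - c)
        = (∫ t in Icc a b, χ t • u t) - m • c := by
          simp only [smul_sub]
          rw [integral_sub (hχ.integrable_smul hu) (hχ.integrable.restrict.smul_const c),
            integral_smul_const, hχ.setIntegral_Icc_eq]
      _ = ∫ t in Icc a b, deriv ψ t • u t := by
          simp only [hderiv, sub_smul, mul_smul]
          rw [integral_sub (hχ.integrable_smul hu) ?_, integral_smul]
          exact (hρ.integrable_smul hu).smul m
      _ = 0 := h₀ ψ hψ
  have hzero := isOpen_Ioo.ae_eq_zero_of_integral_contDiff_smul_eq_zero (U := Ioo a b)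
    ((hu.sub (integrable_const c)).locallyIntegrable.locallyIntegrableOn _)
    fun χ h1 h2 h3 => horth χ ⟨h1, h2, h3⟩
  have hmem : ∀ᵐ t ∂(leb a b), t ∈ Ioo a b := by
    rw [leb, ← restrict_Ioo_eq_restrict_Icc]
    exact ae_restrict_mem measurableSet_Ioo
  exact ⟨c, by filter_upwards [hzero, hmem] with t h1 h2 using sub_eq_zero.1 (h1 h2)⟩

theorem HasWeakDeriv.exists_holderOnWith {d : ℕ} {h : ℝ} (hh : 0 < h) {w g : L2 d 0 h}
    (hw : HasWeakDeriv w g) :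
    ∃ f : ℝ → Vec d, w =ᵐ[leb 0 h] f ∧ HolderOnWith ‖g‖₊ (1 / 2) f (Icc 0 h) := by
  have hg : MemLp g 2 (leb 0 h) := Lp.memLp g
  have hwi : Integrable w (leb 0 h) := (Lp.memLp w).integrable one_le_two
  let G (t : ℝ) : Vec d := ∫ r in 0..t, g r
  have hG : HolderOnWith ‖g‖₊ (1 / 2) G (Icc 0 h) := by
    have hexp : (1 - (2 : ℝ≥0∞).toReal⁻¹).toNNReal = 1 / 2 := by
      ext
      norm_num
    rw [Lp.nnnorm_def, ← hexp]
    exact holderOnWith_intervalIntegral one_le_two hg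
  have hGi : Integrable G (leb 0 h) :=
    (hG.uniformContinuousOn (by norm_num)).continuousOn.integrableOn_Icc
  obtain ⟨c, hc⟩ := ae_eq_const_of_integral_deriv_smul_eq_zero hh (hwi.sub hGi) fun ψ hψ => by
    simp only [Pi.sub_apply, smul_sub]
    rw [integral_sub (hψ.deriv.integrable_smul hwi) (hψ.deriv.integrable_smul hGi),
      hw ψ hψ.contDiff hψ.hasCompactSupport hψ.tsupport_subset,
      hψ.integral_deriv_smul_intervalIntegral (hg.integrable one_le_two), sub_self]
  refine ⟨fun t => c + G t, ?_, fun t ht u hu => ?_⟩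
  · filter_upwards [hc] with t ht
    rw [← ht, Pi.sub_apply, sub_add_cancel]
  · rw [edist_add_left]
    exact hG t ht u hu

end Sobolev

section Volterra

theorem isUnit_one_sub_of_isUnit_one_sub_pow {R : Type*} [Ring R] {x : R} {n : ℕ}
    (hx : IsUnit (1 - x ^ n)) : IsUnit (1 - x) := by
  have hcomm : Commute (1 - x) (∑ i ∈ Finset.range n, x ^ i) :=
    Commute.sum_right _ _ _ fun i _ => (Commute.one_left _).sub_left (Commute.self_pow x i)
  rw [← mul_neg_geom_sum] at hx
  exact (hcomm.isUnit_mul_iff.1 hx).1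

variable {E : Type*} [NormedAddCommGroup E] {p : ℝ≥0∞} {a b M : ℝ}

/-- `T` is dominated pointwise by the Volterra operator with constant kernel `M`. -/
def IsVolterraDominated (M : ℝ) (T : Lp E p (leb a b) → Lp E p (leb a b)) : Prop :=
  ∀ w, ∀ᵐ t ∂(leb a b), ‖T w t‖ ≤ M * ∫ u in a..t, ‖w u‖

variable [Fact (1 ≤ p)]

theorem integrable_norm_Lp (w : Lp E p (leb a b)) : Integrable (fun t => ‖w t‖) (leb a b) :=
  ((Lp.memLp w).integrable Fact.out).norm

theorem setIntegral_norm_Lp_le (hab : a ≤ b) (w : Lp E p (leb a b)) :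
    ∫ t in Icc a b, ‖w t‖ ≤ (b - a) ^ (1 - p.toReal⁻¹) * ‖w‖ := by
  have hw : AEStronglyMeasurable w (leb a b) := Lp.aestronglyMeasurable w
  have hHolder := eLpNorm_le_eLpNorm_mul_rpow_measure_univ (μ := leb a b) (Fact.out : 1 ≤ p) hw
  calc ∫ t in Icc a b, ‖w t‖ = (eLpNorm w 1 (leb a b)).toReal := by
        rw [eLpNorm_one_eq_lintegral_enorm, integral_norm_eq_lintegral_enorm hw]
    _ ≤ (eLpNorm w p (leb a b) * leb a b univ ^ (1 / (1 : ℝ≥0∞).toReal - 1 / p.toReal)).toReal :=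
        ENNReal.toReal_mono (ENNReal.mul_ne_top (Lp.eLpNorm_ne_top w) (ENNReal.rpow_ne_top_of_nonneg
          (by simpa using one_sub_inv_toReal_nonneg Fact.out) (measure_ne_top _ _))) hHolder
    _ = (b - a) ^ (1 - p.toReal⁻¹) * ‖w‖ := by
        rw [ENNReal.toReal_mul, ← ENNReal.toReal_rpow, mul_comm, Lp.norm_def]
        simp [hab]

namespace IsVolterraDominated

theorem norm_iterate_succ_apply_le {T : Lp E p (leb a b) → Lp E p (leb a b)}
    (hT : IsVolterraDominated M T) (hM : 0 ≤ M) (w : Lp E p (leb a b)) (n : ℕ) :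
    ∀ᵐ t ∂(leb a b), ‖(T^[n + 1] w) t‖ ≤
      M ^ (n + 1) * (∫ u in Icc a b, ‖w u‖) * ((t - a) ^ n / n.factorial) := by
  set c := ∫ u in Icc a b, ‖w u‖
  induction n with
  | zero =>
    filter_upwards [hT w, ae_restrict_mem measurableSet_Icc] with t hTt ht
    have hmono : ∫ u in a..t, ‖w u‖ ≤ c := by
      rw [intervalIntegral.integral_of_le ht.1]
      exact setIntegral_mono_set (integrable_norm_Lp w) (ae_of_all _ fun _ => norm_nonneg _)
        (Ioc_subset_Icc_self.trans (Icc_subset_Icc_right ht.2)).eventuallyLE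
    simpa using hTt.trans (mul_le_mul_of_nonneg_left hmono hM)
  | succ n ih =>
    filter_upwards [hT (T^[n + 1] w), ae_restrict_mem measurableSet_Icc] with t hTt ht
    have hrestrict : volume.restrict (Icc a t) ≤ leb a b :=
      Measure.restrict_mono (Icc_subset_Icc_right ht.2) le_rfl
    have hint : IntervalIntegrable (fun u => ‖(T^[n + 1] w) u‖) volume a t :=
      (intervalIntegrable_iff_integrableOn_Icc_of_le ht.1).2
        ((integrable_norm_Lp _).mono_measure hrestrict)
    rw [Function.iterate_succ_apply']
    calc ‖T (T^[n + 1] w) t‖ ≤ M * ∫ u in a..t, ‖(T^[n + 1] w) u‖ := hTt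
      _ ≤ M * ∫ u in a..t, M ^ (n + 1) * c * ((u - a) ^ n / n.factorial) := by
          gcongr
          exact intervalIntegral.integral_mono_ae_restrict ht.1 hint
            (Continuous.intervalIntegrable (by fun_prop) _ _) (ae_mono hrestrict ih)
      _ = M ^ (n + 1 + 1) * c * ((t - a) ^ (n + 1) / (n + 1).factorial) := by
          rw [intervalIntegral.integral_const_mul, intervalIntegral.integral_div,
            intervalIntegral.integral_comp_sub_right (fun u => u ^ n), integral_pow,
            Nat.factorial_succ]
          push_cast
          field_simp
          ring

theorem norm_iterate_succ_le {T : Lp E p (leb a b) → Lp E p (leb a b)}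
    (hT : IsVolterraDominated M T) (hM : 0 ≤ M) (hab : a ≤ b) (n : ℕ) (w : Lp E p (leb a b)) :
    ‖T^[n + 1] w‖ ≤ M * (b - a) * ((M * (b - a)) ^ n / n.factorial) * ‖w‖ := by
  have hba : 0 ≤ b - a := sub_nonneg.2 hab
  have hp : 0 ≤ 1 - p.toReal⁻¹ := one_sub_inv_toReal_nonneg Fact.out
  have hbound : ∀ᵐ t ∂(leb a b), ‖(T^[n + 1] w) t‖ ≤
      M ^ (n + 1) * ((b - a) ^ (1 - p.toReal⁻¹) * ‖w‖) * ((b - a) ^ n / n.factorial) := by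
    filter_upwards [hT.norm_iterate_succ_apply_le hM w n, ae_restrict_mem measurableSet_Icc]
      with t htT ht
    have hta : 0 ≤ t - a := sub_nonneg.2 ht.1
    refine htT.trans ?_
    gcongr
    · exact setIntegral_norm_Lp_le hab w
    · exact ht.2
  calc ‖T^[n + 1] w‖ ≤ (b - a) ^ p.toReal⁻¹ *
        (M ^ (n + 1) * ((b - a) ^ (1 - p.toReal⁻¹) * ‖w‖) * ((b - a) ^ n / n.factorial)) := by
        have := Lp.norm_le_of_ae_bound (by positivity) hbound
        simpa [measureUnivNNReal, ENNReal.coe_toNNReal_eq_toReal, hab] using this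
    _ = (b - a) ^ p.toReal⁻¹ * (b - a) ^ (1 - p.toReal⁻¹) *
          (M ^ (n + 1) * ((b - a) ^ n / n.factorial) * ‖w‖) := by ring
    _ = M * (b - a) * ((M * (b - a)) ^ n / n.factorial) * ‖w‖ := by
        rw [← Real.rpow_add_of_nonneg hba (by positivity) hp, add_sub_cancel, Real.rpow_one,
          mul_pow]
        ring

theorem exists_inverse_id_sub [NormedSpace ℝ E] [CompleteSpace E]
    {T : Lp E p (leb a b) →ₗ[ℝ] Lp E p (leb a b)} (hT : IsVolterraDominated M T) (hM : 0 ≤ M)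
    (hab : a ≤ b) : ∃ S : Lp E p (leb a b) →L[ℝ] Lp E p (leb a b),
      Function.LeftInverse S (fun w => w - T w) ∧ Function.RightInverse S (fun w => w - T w) := by
  have : 0 ≤ b - a := sub_nonneg.2 hab
  have hbound := hT.norm_iterate_succ_le hM hab
  let T' : Lp E p (leb a b) →L[ℝ] Lp E p (leb a b) :=
    T.mkContinuous (M * (b - a)) fun w => by simpa using hbound 0 w
  have hlim : Filter.Tendsto (fun n : ℕ => M * (b - a) * ((M * (b - a)) ^ n / n.factorial))
      Filter.atTop (nhds 0) := by
    simpa using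
      (FloorSemiring.tendsto_pow_div_factorial_atTop (M * (b - a))).const_mul (M * (b - a))
  obtain ⟨n, hn⟩ := (hlim.eventually (gt_mem_nhds one_pos)).exists
  have hpow : ‖T' ^ (n + 1)‖ < 1 := by
    refine (ContinuousLinearMap.opNorm_le_bound _ (by positivity) fun w => ?_).trans_lt hn
    rw [FunLike.coe_pow_eq_iterate]
    exact hbound n w
  obtain ⟨U, hU⟩ : IsUnit (1 - T') :=
    isUnit_one_sub_of_isUnit_one_sub_pow (isUnit_one_sub_of_norm_lt_one hpow)
  let e := ContinuousLinearEquiv.ofUnit U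
  have he (w : Lp E p (leb a b)) : e w = w - T w := DFunLike.congr_fun hU w
  refine ⟨e.symm, fun w => ?_, fun w => ?_⟩
  · simp only [← he]
    exact e.symm_apply_apply w
  · simp only [← he]
    exact e.apply_symm_apply w

end IsVolterraDominated

end Volterra

section DelayOperator

variable {d : ℕ} {s τ h : ℝ} {C : ℝ → ℝ → Matrix (Fin d) (Fin d) ℝ}

theorem Vplus_ae_eq (w : L2 d 0 h) : Vplus d τ h w =ᵐ[leb (-τ) h] (Ioc 0 h).indicator w := by
  have hglue : Vplus d τ h w =ᵐ[leb (-τ) h] glueFun h (0 : L2 d (-τ) 0) w :=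
    (memLp_glueFun (0 : L2 d (-τ) 0) w).coeFn_toLp
  refine hglue.trans ((glueFun_congr_ae (Lp.coeFn_zero _ _ _) .rfl).trans ?_)
  rw [glueFun_eq_piecewise, piecewise_eq_indicator]

theorem setIntegral_norm_Vplus_le (w : L2 d 0 h) {t : ℝ} (ht : t ∈ Icc 0 h) :
    ∫ θ in Icc (-τ) 0, ‖Vplus d τ h w (t + θ)‖ ≤ ∫ u in 0..t, ‖w u‖ := by
  have hae : (fun u => ‖Vplus d τ h w u‖) =ᵐ[leb (t - τ) t]
      (Ioc 0 h).indicator fun u => ‖w u‖ := by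
    filter_upwards [ae_mono (leb_translate_le ht) (Vplus_ae_eq w)] with u hu
    rw [hu, norm_indicator_eq_indicator_norm]
  rw [(translate_measurePreserving τ t).integral_comp (measurableEmbedding_addLeft t)
      (fun u => ‖Vplus d τ h w u‖), integral_congr_ae hae,
    setIntegral_indicator measurableSet_Ioc, intervalIntegral.integral_of_le ht.1]
  have hint : IntegrableOn (fun u => ‖w u‖) (Ioc 0 t) :=
    IntegrableOn.mono_set (integrable_norm_Lp w)
      (Ioc_subset_Icc_self.trans (Icc_subset_Icc_right ht.2))
  exact setIntegral_mono_set hint (ae_of_all _ fun _ => norm_nonneg _)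
    (LE.le.eventuallyLE fun u hu => ⟨hu.2.1, hu.1.2⟩)

theorem HypH1.exists_isVolterraDominated_FVplus (hC : HypH1 s τ h C) :
    ∃ M, 0 ≤ M ∧ IsVolterraDominated M (FVplus hC) := by
  obtain ⟨K, hK0, hK⟩ := hC.exists_bound
  refine ⟨d * (d * K), by positivity, fun w => ?_⟩
  have hF : FVplus hC w =ᵐ[leb 0 h] delayIntegral s τ C (Vplus d τ h w) :=
    (hC.memLp_delayIntegral (Vplus d τ h w)).coeFn_toLp
  filter_upwards [hF, hK, ae_restrict_mem measurableSet_Icc] with t hFt hKt ht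
  calc ‖FVplus hC w t‖ = ‖delayIntegral s τ C (Vplus d τ h w) t‖ := by rw [hFt]
    _ ≤ ∫ θ in Icc (-τ) 0, (d * (d * K)) * ‖Vplus d τ h w (t + θ)‖ := by
        refine norm_integral_le_of_norm_le ((integrable_translate _ ht).norm.const_mul _) ?_
        filter_upwards [hKt] with θ hθ
        exact norm_toEuclideanLin_le _ _ hθ
    _ = (d * (d * K)) * ∫ θ in Icc (-τ) 0, ‖Vplus d τ h w (t + θ)‖ := integral_const_mul _ _
    _ ≤ (d * (d * K)) * ∫ u in 0..t, ‖w u‖ := by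
        gcongr
        exact setIntegral_norm_Vplus_le w ht

end DelayOperator

section Convergence

theorem norm_sq_eq_setIntegral_norm_sq {E : Type*} [NormedAddCommGroup E] [InnerProductSpace ℝ E]
    {a b : ℝ} (u : Lp E 2 (leb a b)) : ‖u‖ ^ 2 = ∫ t in Icc a b, ‖u t‖ ^ 2 := by
  rw [← real_inner_self_eq_norm_sq, L2.inner_def]
  simp only [real_inner_self_eq_norm_sq]

variable {d : ℕ} {h : ℝ}

theorem interp_ae_eq (hh : 0 < h) (Y : EvaluationSpace d h) (N : ℕ) (w : Y.carrier)
    {f : ℝ → Vec d} (hf : ContinuousOn f (Icc 0 h)) (hwf : w =ᵐ[leb 0 h] f) :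
    interp Y N w =ᵐ[leb 0 h] lagrangeInterp (nodes h N) f := by
  have heval : EqOn (Y.eval w) f (Icc 0 h) := Y.eval_of_continuousOn w f hf hwf
  have hinterp : lagrangeInterp (nodes h N) (Y.eval w) = lagrangeInterp (nodes h N) f := by
    ext1 t
    exact Finset.sum_congr rfl fun θ hθ => by
      rw [heval (Ioo_subset_Icc_self (nodes_subset_Ioo hh N hθ))]
  rw [← hinterp]
  exact (memLp_interpFun N (Y.eval w)).coeFn_toLp

theorem norm_interp_sub_le_of_holderOnWith (hh : 0 < h) (Y : EvaluationSpace d h) (w : Y.carrier)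
    {f : ℝ → Vec d} (hwf : w =ᵐ[leb 0 h] f) {K r : ℝ≥0} (hf : HolderOnWith K r f (Icc 0 h))
    (hr₀ : 0 < r) (hr : r ≤ 2) {n : ℕ} (hn : n ≠ 0) :
    ‖interp Y (n + 1) w - w‖ ≤
      2 * (√h * (K * h ^ (r : ℝ) * (1 / n : ℝ) ^ (r / 2 : ℝ))) := by
  have hfc : ContinuousOn f (Icc 0 h) := (hf.uniformContinuousOn hr₀).continuousOn
  obtain ⟨p, hp, hfp⟩ := exists_polynomialFunction_norm_sub_le_of_holderOnWith hh hf hr hn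
  rw [← card_nodes hh (n + 1)] at hp
  simp only [sub_zero] at hfp
  set B : ℝ := K * h ^ (r : ℝ) * (1 / n : ℝ) ^ (r / 2 : ℝ)
  have hae : (fun t => ‖(interp Y (n + 1) w - w : L2 d 0 h) t‖ ^ 2) =ᵐ[leb 0 h]
      fun t => ‖lagrangeInterp (nodes h (n + 1)) f t - f t‖ ^ 2 := by
    filter_upwards [Lp.coeFn_sub (interp Y (n + 1) w) (w : L2 d 0 h),
      interp_ae_eq hh Y (n + 1) w hfc hwf, hwf] with t hsub hinterp hw
    rw [hsub, Pi.sub_apply, hinterp, hw]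
  refine (pow_le_pow_iff_left₀ (norm_nonneg _) (by positivity) two_ne_zero).1 ?_
  calc ‖interp Y (n + 1) w - w‖ ^ 2
      = ∫ t in 0..h, ‖lagrangeInterp (nodes h (n + 1)) f t - f t‖ ^ 2 := by
        rw [norm_sq_eq_setIntegral_norm_sq, integral_congr_ae hae,
          intervalIntegral.integral_of_le hh.le, integral_Icc_eq_integral_Ioc]
    _ ≤ 4 * ((h - 0) * B ^ 2) :=
        (isGaussNodes_nodes hh (n + 1)).integral_norm_lagrangeInterp_sub_sq_le
          ((nodes_subset_Ioo hh _).trans Ioo_subset_Icc_self) hh.le hfc hp hfp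
    _ = (2 * (√h * B)) ^ 2 := by
        linear_combination -4 * B ^ 2 * Real.sq_sqrt hh.le

theorem eventually_norm_interp_sub_le_of_holderOnWith (d : ℕ) (hh : 0 < h) {r : ℝ≥0} (hr₀ : 0 < r)
    (hr : r ≤ 2) {ε : ℝ} (hε : 0 < ε) :
    ∀ᶠ N in Filter.atTop, ∀ (Y : EvaluationSpace d h) (w : Y.carrier) (f : ℝ → Vec d) (K : ℝ≥0),
      w =ᵐ[leb 0 h] f → HolderOnWith K r f (Icc 0 h) → ‖interp Y N w - w‖ ≤ ε * K := by
  have hrate : Filter.Tendsto (fun n : ℕ => 2 * (√h * h ^ (r : ℝ)) * (1 / n : ℝ) ^ (r / 2 : ℝ))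
      Filter.atTop (nhds 0) := by
    have hrpow := tendsto_one_div_atTop_nhds_zero_nat.rpow_const (p := (r / 2 : ℝ))
      (.inr (by positivity))
    rw [Real.zero_rpow (by positivity)] at hrpow
    simpa using hrpow.const_mul (2 * (√h * h ^ (r : ℝ)))
  rw [← Filter.map_add_atTop_eq_nat 1, Filter.eventually_map]
  filter_upwards [hrate.eventually_le_const hε, Filter.eventually_ne_atTop 0]
    with n hnε hn Y w f K hwf hf
  calc ‖interp Y (n + 1) w - w‖
      ≤ 2 * (√h * (K * h ^ (r : ℝ) * (1 / n : ℝ) ^ (r / 2 : ℝ))) :=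
        norm_interp_sub_le_of_holderOnWith hh Y w hwf hf hr₀ hr hn
    _ = 2 * (√h * h ^ (r : ℝ)) * (1 / n : ℝ) ^ (r / 2 : ℝ) * K := by ring
    _ ≤ ε * K := by gcongr

variable {s τ : ℝ} {C : ℝ → ℝ → Matrix (Fin d) (Fin d) ℝ} {hC : HypH1 s τ h C}

theorem HypH2.exists_weakDeriv_norm_le (hF : HypH2 hC) :
    ∃ K : ℝ≥0, ∀ w, ∃ g, HasWeakDeriv (FVplus hC w) g ∧ ‖g‖ ≤ K * ‖w‖ := by
  obtain ⟨hmem, K, hK⟩ := hF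
  refine ⟨K.toNNReal, fun w => ?_⟩
  obtain ⟨g, hg⟩ := hmem w
  refine ⟨g, hg, ?_⟩
  calc ‖g‖ ≤ √(‖FVplus hC w‖ ^ 2 + ‖g‖ ^ 2) :=
        Real.le_sqrt_of_sq_le (le_add_of_nonneg_left (sq_nonneg _))
    _ ≤ K * ‖w‖ := hK w g hg
    _ ≤ K.toNNReal * ‖w‖ := by
        gcongr
        exact Real.le_coe_toNNReal K

theorem HypH2.eventually_norm_interp_FVplus_sub_le (hF : HypH2 hC) (hh : 0 < h)
    (Y : EvaluationSpace d h) {ε : ℝ} (hε : 0 < ε) :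
    ∀ᶠ N in Filter.atTop, ∀ w,
      ‖interp Y N ⟨FVplus hC w, Y.sobolev_le (hF.1 w)⟩ - FVplus hC w‖ ≤ ε * ‖w‖ := by
  obtain ⟨K, hK⟩ := hF.exists_weakDeriv_norm_le
  filter_upwards [eventually_norm_interp_sub_le_of_holderOnWith d hh one_half_pos
    (one_half_lt_one.le.trans one_le_two) (show 0 < ε / (K + 1) by positivity)] with N hN w
  obtain ⟨g, hg, hgw⟩ := hK w
  obtain ⟨f, hwf, hf⟩ := hg.exists_holderOnWith hh
  calc ‖interp Y N ⟨FVplus hC w, Y.sobolev_le (hF.1 w)⟩ - FVplus hC w‖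
      ≤ ε / (K + 1) * ‖g‖ := hN Y ⟨FVplus hC w, Y.sobolev_le (hF.1 w)⟩ f ‖g‖₊ hwf hf
    _ ≤ ε / (K + 1) * ((K + 1) * ‖w‖) := by
        gcongr
        exact hgw.trans (by gcongr; exact le_add_of_nonneg_right zero_le_one)
    _ = ε * ‖w‖ := by field_simp

end Convergence

section Perturbation

theorem exists_inverse_of_norm_sub_le {𝕜 X : Type*} [NontriviallyNormedField 𝕜]
    [NormedAddCommGroup X] [NormedSpace 𝕜 X] [CompleteSpace X] {A B : X →ₗ[𝕜] X} {S : X →L[𝕜] X}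
    (hSA : Function.LeftInverse S A) (hAS : Function.RightInverse S A) {ε : ℝ} (hε₀ : 0 ≤ ε)
    (hε : ‖S‖ * ε < 1) (hAB : ∀ x, ‖A x - B x‖ ≤ ε * ‖x‖) :
    ∃ S' : X →L[𝕜] X, Function.LeftInverse S' B ∧ Function.RightInverse S' B ∧
      ‖S'‖ ≤ (1 - ‖S‖ * ε)⁻¹ * ‖S‖ := by
  let D : X →L[𝕜] X := (A - B).mkContinuous ε hAB
  have hD (x : X) : D x = A x - B x := rfl
  have hSD : ‖S * D‖ ≤ ‖S‖ * ε := (norm_mul_le _ _).trans <|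
    mul_le_mul_of_nonneg_left ((A - B).mkContinuous_norm_le hε₀ hAB) (norm_nonneg _)
  have hpos : 0 < 1 - ‖S‖ * ε := sub_pos.2 hε
  obtain ⟨U, hU⟩ : IsUnit (1 - S * D) := isUnit_one_sub_of_norm_lt_one (hSD.trans_lt hε)
  let e := ContinuousLinearEquiv.ofUnit U
  have he (x : X) : e x = S (B x) := by
    rw [show e x = x - S (D x) from DFunLike.congr_fun hU x, hD, map_sub, hSA, sub_sub_cancel]
  have hB (x : X) : S (B (e.symm (S x))) = S x := by rw [← he, e.apply_symm_apply]
  refine ⟨e.symm.toContinuousLinearMap * S, fun x => ?_, fun x => hAS.injective (hB x), ?_⟩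
  · change e.symm (S (B x)) = x
    rw [← he, e.symm_apply_apply]
  · refine ContinuousLinearMap.opNorm_le_bound _ (by positivity) fun x => ?_
    change ‖e.symm (S x)‖ ≤ _
    set y := e.symm (S x)
    have hy : y = S x + (S * D) y := by
      change y = S x + S (D y)
      rw [hD, map_sub, hSA, hB, add_sub_cancel]
    have hnorm : ‖y‖ ≤ ‖S‖ * ‖x‖ + ‖S‖ * ε * ‖y‖ := by
      calc ‖y‖ = ‖S x + (S * D) y‖ := congrArg norm hy
        _ ≤ ‖S x‖ + ‖(S * D) y‖ := norm_add_le _ _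
        _ ≤ ‖S‖ * ‖x‖ + ‖S‖ * ε * ‖y‖ :=
          add_le_add (S.le_opNorm x) ((S * D).le_of_opNorm_le hSD y)
    rw [mul_assoc, le_inv_mul_iff₀ hpos]
    linarith

end Perturbation

section Equations

variable {d : ℕ} {s τ h : ℝ} {C : ℝ → ℝ → Matrix (Fin d) (Fin d) ℝ} {hC : HypH1 s τ h C}

theorem exists_isBoundedInverse_exactOp (hC : HypH1 s τ h C) (hh : 0 ≤ h) :
    ∃ S, IsBoundedInverse (exactOp hC) S :=
  let ⟨_, hM, hV⟩ := hC.exists_isVolterraDominated_FVplus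
  hV.exists_inverse_id_sub hM hh

theorem eventually_exists_isBoundedInverse_collocationOp (hF : HypH2 hC) (hh : 0 < h)
    (Y : EvaluationSpace d h) {S : L2 d 0 h →L[ℝ] L2 d 0 h}
    (hS : IsBoundedInverse (exactOp hC) S) :
    ∀ᶠ N in Filter.atTop,
      ∃ SN, IsBoundedInverse (collocationOp hF Y N) SN ∧ ‖SN‖ ≤ 2 * ‖S‖ := by
  have hε : 0 < (2 * (‖S‖ + 1))⁻¹ := by positivity
  have hhalf : ‖S‖ * (2 * (‖S‖ + 1))⁻¹ ≤ 1 / 2 := by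
    rw [← div_eq_mul_inv, div_le_div_iff₀ (by positivity) two_pos]
    linarith
  filter_upwards [hF.eventually_norm_interp_FVplus_sub_le hh Y hε] with N hN
  have hdiff (w : L2 d 0 h) : exactOp hC w - collocationOp hF Y N w =
      interp Y N ⟨FVplus hC w, Y.sobolev_le (hF.1 w)⟩ - FVplus hC w :=
    sub_sub_sub_cancel_left _ _ w
  obtain ⟨SN, hleft, hright, hnorm⟩ := exists_inverse_of_norm_sub_le (B := collocationOp hF Y N)
    hS.1 hS.2 hε.le (hhalf.trans_lt one_half_lt_one) fun w => (hdiff w).symm ▸ hN w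
  refine ⟨SN, ⟨hleft, hright⟩, hnorm.trans ?_⟩
  gcongr
  exact inv_le_of_inv_le₀ two_pos (by linarith)

theorem F_V_eq_add (hC : HypH1 s τ h C) (φ : L2 d (-τ) 0) (w : L2 d 0 h) :
    F hC (V d τ h (φ, w)) = FVminus hC φ + FVplus hC w := by
  rw [show (φ, w) = (φ, 0) + (0, w) by simp, map_add, map_add]
  rfl

theorem isFixedPoint_iff {φ : L2 d (-τ) 0} {w : L2 d 0 h} :
    IsFixedPoint hC φ w ↔ exactOp hC w = FVminus hC φ := by
  rw [IsFixedPoint, F_V_eq_add, exactOp, LinearMap.sub_apply, LinearMap.id_apply,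
    sub_eq_iff_eq_add]

theorem mem_carrier_of_eq_add (hF : HypH2 hC) (Y : EvaluationSpace d h) {y z w : L2 d 0 h}
    (hy : y ∈ Y.carrier) (hz : z = y + FVplus hC w) : z ∈ Y.carrier :=
  hz ▸ Y.carrier.add_mem hy (Y.sobolev_le (hF.1 w))

theorem collocationOp_eq_sub_interp_add_interp (hF : HypH2 hC) (Y : EvaluationSpace d h) (N : ℕ)
    {y z w : L2 d 0 h} (hy : y ∈ Y.carrier) (hz : z = y + FVplus hC w) :
    collocationOp hF Y N w =
      w - interp Y N ⟨z, mem_carrier_of_eq_add hF Y hy hz⟩ + interp Y N ⟨y, hy⟩ := by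
  subst hz
  have hadd : interp Y N ⟨y + FVplus hC w, mem_carrier_of_eq_add hF Y hy rfl⟩ =
      interp Y N ⟨y, hy⟩ + interp Y N ⟨FVplus hC w, Y.sobolev_le (hF.1 w)⟩ := by
    rw [← map_add]
    exact congrArg _ (Subtype.ext rfl)
  rw [hadd]
  change w - interp Y N ⟨FVplus hC w, Y.sobolev_le (hF.1 w)⟩ = _
  abel

theorem isCollocationSolution_iff (hF : HypH2 hC) {Y : EvaluationSpace d h} {N : ℕ}
    {φ : L2 d (-τ) 0} (hφ : FVminus hC φ ∈ Y.carrier) {w : L2 d 0 h} :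
    IsCollocationSolution hC Y N φ w ↔
      collocationOp hF Y N w = interp Y N ⟨FVminus hC φ, hφ⟩ := by
  have hsum := F_V_eq_add hC φ w
  rw [collocationOp_eq_sub_interp_add_interp hF Y N hφ hsum, add_eq_right, sub_eq_zero]
  exact ⟨fun ⟨_, hw⟩ => hw, fun hw => ⟨_, hw⟩⟩

theorem IsFixedPoint.mem_carrier (hF : HypH2 hC) {Y : EvaluationSpace d h} {φ : L2 d (-τ) 0}
    (hφ : FVminus hC φ ∈ Y.carrier) {w : L2 d 0 h} (hw : IsFixedPoint hC φ w) : w ∈ Y.carrier :=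
  mem_carrier_of_eq_add hF Y hφ (hw.trans (F_V_eq_add hC φ w))

theorem IsFixedPoint.collocationOp_sub (hF : HypH2 hC) {Y : EvaluationSpace d h} {N : ℕ}
    {φ : L2 d (-τ) 0} (hφ : FVminus hC φ ∈ Y.carrier) {w wN : L2 d 0 h}
    (hw : IsFixedPoint hC φ w) (hwN : IsCollocationSolution hC Y N φ wN) :
    collocationOp hF Y N (wN - w) = interp Y N ⟨w, hw.mem_carrier hF hφ⟩ - w := by
  rw [map_sub, (isCollocationSolution_iff hF hφ).1 hwN,
    collocationOp_eq_sub_interp_add_interp hF Y N hφ (hw.trans (F_V_eq_add hC φ w))]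
  abel

theorem IsBoundedInverse.apply_eq_iff {A : L2 d 0 h →ₗ[ℝ] L2 d 0 h} {S : L2 d 0 h →L[ℝ] L2 d 0 h}
    (hS : IsBoundedInverse A S) {w y : L2 d 0 h} : A w = y ↔ w = S y :=
  ⟨fun hw => hw ▸ (hS.1 w).symm, fun hw => hw ▸ hS.2 y⟩

theorem IsBoundedInverse.norm_le {A : L2 d 0 h →ₗ[ℝ] L2 d 0 h} {S : L2 d 0 h →L[ℝ] L2 d 0 h}
    (hS : IsBoundedInverse A S) {c : ℝ} (hc : ‖S‖ ≤ c) (w : L2 d 0 h) : ‖w‖ ≤ c * ‖A w‖ := by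
  simpa only [hS.1] using S.le_of_opNorm_le hc (A w)

end Equations

end RenewalCollocation

theorem mainTheorem4 (d : ℕ) (s τ h : ℝ) (hτ : 0 < τ) (hh : 0 < h)
    (C : ℝ → ℝ → Matrix (Fin d) (Fin d) ℝ) (hC : HypH1 s τ h C) (hF : HypH2 hC)
    (Y : EvaluationSpace d h) :
    ∃ S : L2 d 0 h →L[ℝ] L2 d 0 h, IsBoundedInverse (exactOp hC) S ∧
    ∃ N₀ : ℕ, 0 < N₀ ∧ ∀ N : ℕ, N₀ ≤ N →
      (∃ SN : L2 d 0 h →L[ℝ] L2 d 0 h,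
        IsBoundedInverse (collocationOp hF Y N) SN ∧ ‖SN‖ ≤ 2 * ‖S‖) ∧
      ∀ φ : L2 d (-τ) 0, ∃ w : L2 d 0 h,
        (IsFixedPoint hC φ w ∧ ∀ w', IsFixedPoint hC φ w' → w' = w) ∧
        (FVminus hC φ ∈ Y.carrier →
          ∃ wN : L2 d 0 h,
            (IsCollocationSolution hC Y N φ wN ∧
              ∀ w', IsCollocationSolution hC Y N φ w' → w' = wN) ∧
            ∃ hw : w ∈ Y.carrier,
              ‖wN - w‖ ≤ 2 * ‖S‖ * ‖interp Y N ⟨w, hw⟩ - w‖) := by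
  obtain ⟨S, hS⟩ := exists_isBoundedInverse_exactOp hC hh.le
  obtain ⟨N₀, hN₀⟩ :=
    Filter.eventually_atTop.1 (eventually_exists_isBoundedInverse_collocationOp hF hh Y hS)
  refine ⟨S, hS, N₀ + 1, N₀.succ_pos, fun N hN => ?_⟩
  obtain ⟨SN, hSN, hnorm⟩ := hN₀ N (N₀.le_succ.trans hN)
  refine ⟨⟨SN, hSN, hnorm⟩, fun φ => ?_⟩
  have hfixed (w : L2 d 0 h) : IsFixedPoint hC φ w ↔ w = S (FVminus hC φ) :=
    isFixedPoint_iff.trans hS.apply_eq_iff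
  have hw := (hfixed _).2 rfl
  refine ⟨_, ⟨hw, fun w' => (hfixed w').1⟩, fun hφ => ?_⟩
  have hcolloc (w : L2 d 0 h) :
      IsCollocationSolution hC Y N φ w ↔ w = SN (interp Y N ⟨FVminus hC φ, hφ⟩) :=
    (isCollocationSolution_iff hF hφ).trans hSN.apply_eq_iff
  have hwN := (hcolloc _).2 rfl
  refine ⟨_, ⟨hwN, fun w' => (hcolloc w').1⟩, hw.mem_carrier hF hφ, ?_⟩
  rw [← hw.collocationOp_sub hF hφ hwN]
  exact hSN.norm_le hnorm _
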